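/- Consider a word RAM with \(w\)-bit words. A wildcard index consists of a read-only array of words (its \emph{space} is the number of words) together with a fixed finite query program. A query presents a pattern \(p\) over an alphabet of size \(\sigma\), with \(m>0\) characters and \(j\) wildcards, each wildcard matching any single character of the text. The index must report each of the \(occ\) positions at which \(p\) occurs in the nonempty text \(t\) of length \(n\) exactly once. The \emph{query time} is the number of unit-cost machine steps. The index is \(k\)-bounded if it answers all patterns with \(j\le k\). As usual, words are large enough to hold the characters, text positions, the pattern length (\(\sigma,\,n,\,m+j<2^w\)) and the addresses of the index, as made precise below. Let \(h\) be the height of the suffix tree of \(t\), i.e. of the compressed trie of the nonempty suffixes of \(t\$\), where \(\$\) is an end marker outside the alphabet. \textbf{Lemma.} For every constant \(c\) there is a constant \(C\), depending only on \(c\), such that every query program \(P_{\mathcal A}\) can be turned into a query program \(P_{\mathcal B}\), depending only on \(c\) and \(P_{\mathcal A}\), with the following property. Let \(w,k,\sigma\) be natural numbers and let \(t\) be a nonempty text of length \(n<2^w\) over an alphabet of size \(\sigma<2^w\). Let \(F\) be a real function of the pattern with \(F\ge m\), let \(G\ge 0\) be a real number that does not depend on the pattern (in particular not on \(m\) and \(j\)),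 and let \(S\) be a real number. Suppose that \(P_{\mathcal A}\) with an array of at most \(S\) words is a wildcard index \(\mathcal A\) for \(t\) that answers every pattern with \(j\le k\) wildcards in time at most \(c\,(F+G+occ)\), and that \(C\,(n\min(G,h)^k+S)\le 2^w\). Then there is an array of at most \[ C\,\bigl(n\min(G,h)^k+S\bigr) \] words which together with \(P_{\mathcal B}\) is a \(k\)-bounded wildcard index \(\mathcal B\) for \(t\) with query time at most \[ C\,(F+j+occ). \] In short: a wildcard index with query time \(O(F+G+occ)\) and space \(S\) yields a \(k\)-bounded wildcard index with query time \(O(F+j+occ)\) and space \(O(n\min(G,h)^k+S)\). -/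

import Mathlib

namespace WildcardIndexing

/-! ### Texts, patterns and occurrences

The alphabet is `Fin σ`.  A text is a list of characters; a pattern is a list of symbols, each of
which is a character (`some a`) or the wildcard (`none`). -/

abbrev Text (σ : ℕ) := List (Fin σ)

abbrev Pattern (σ : ℕ) := List (Option (Fin σ))

/-- The number `m` of characters of a pattern. -/
def numChars {σ : ℕ} (p : Pattern σ) : ℕ := p.countP Option.isSome

/-- The number `j` of wildcards of a pattern. -/
def numWild {σ : ℕ} (p : Pattern σ) : ℕ := p.countP Option.isNone

/-- `p` occurs in `t` at position `l` (positions are `1, …, |t|`): the `|p|` characters of `t` that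
start at `l` exist, and those opposite a character of `p` agree with it. -/
def IsOccurrence {σ : ℕ} (t : Text σ) (p : Pattern σ) (l : ℕ) : Prop :=
  1 ≤ l ∧ l + p.length ≤ t.length + 1 ∧
    ∀ (i : ℕ) (a : Fin σ), p[i]? = some (some a) → t[l - 1 + i]? = some a

open Classical in
/-- The set of positions at which `p` occurs in `t`. -/
noncomputable def occurrences {σ : ℕ} (t : Text σ) (p : Pattern σ) : Finset ℕ :=
  (Finset.Icc 1 t.length).filter (IsOccurrence t p)

/-- The number `occ` of occurrences of `p` in `t`. -/
noncomputable def occ {σ : ℕ} (t : Text σ) (p : Pattern σ) : ℕ := (occurrences t p).card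

/-! ### Compressed tries and the suffix tree

A location of the compressed trie of a prefix-free set `S` is identified with the string spelled on
the path from the root to it. -/

/-- `x` is an (explicit) vertex of the compressed trie `T(S)`: the root, a leaf, or a string that
is continued by two different letters in `S`. -/
def IsTrieVertex {α : Type*} (S : Finset (List α)) (x : List α) : Prop :=
  x = [] ∨ x ∈ S ∨
    ∃ y ∈ S, ∃ z ∈ S, ∃ a b : α, a ≠ b ∧ (x ++ [a]) <+: y ∧ (x ++ [b]) <+: z

open Classical in
/-- The number of edges between the root and the vertex `x` of `T(S)`, that is, the number of
vertices that are proper prefixes of `x`. -/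
noncomputable def trieDepth {α : Type*} (S : Finset (List α)) (x : List α) : ℕ :=
  ((Finset.range x.length).filter (fun i => IsTrieVertex S (x.take i))).card

/-- The number of edges on a longest path from the root of `T(S)` to a leaf. -/
noncomputable def trieHeight {α : Type*} (S : Finset (List α)) : ℕ := S.sup (trieDepth S)

/-- The text followed by an end marker `⊤` outside the alphabet. -/
def terminated {σ : ℕ} (t : Text σ) : List (WithTop (Fin σ)) :=
  t.map (fun a => (a : WithTop (Fin σ))) ++ [⊤]

/-- The nonempty suffixes of the terminated text. -/
def suffixSet {σ : ℕ} (t : Text σ) : Finset (List (WithTop (Fin σ))) :=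
  (terminated t).tails.toFinset.erase []

/-- The height of the suffix tree of `t`. -/
noncomputable def suffixTreeHeight {σ : ℕ} (t : Text σ) : ℕ := trieHeight (suffixSet t)

/-! ### The word RAM

Words have `w` bits.  A query program is a fixed finite program over registers; it reads the index
and the pattern (two read-only arrays of words), has a random-access working memory that is
addressed by words, and reports words to an output. Every instruction and every test of a branch or
of a loop takes one unit of time. -/

/-- The arithmetical, logical and comparison instructions. -/
inductive BinOp
  | add | sub | mul | div | mod | and | or | xor | shl | shr | lt | eq

/-- Arithmetic is unsigned and modulo `2 ^ w`; comparisons return `1` or `0`. -/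
def BinOp.eval {w : ℕ} : BinOp → BitVec w → BitVec w → BitVec w
  | .add, x, y => x + y
  | .sub, x, y => x - y
  | .mul, x, y => x * y
  | .div, x, y => x / y
  | .mod, x, y => x % y
  | .and, x, y => x &&& y
  | .or, x, y => x ||| y
  | .xor, x, y => x ^^^ y
  | .shl, x, y => x <<< y.toNat
  | .shr, x, y => x >>> y.toNat
  | .lt, x, y => if x.toNat < y.toNat then BitVec.ofNat w 1 else 0
  | .eq, x, y => if x = y then BitVec.ofNat w 1 else 0

/-- Programs; the natural numbers `r`, `a`, `b` are names of registers. -/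
inductive Program
  /-- `r := v` -/
  | const (r v : ℕ)
  /-- `r := a o b` -/
  | op (o : BinOp) (r a b : ℕ)
  /-- `r := index[a]` -/
  | readIndex (r a : ℕ)
  /-- `r := pattern[a]` -/
  | readPattern (r a : ℕ)
  /-- `r := memory[a]` -/
  | load (r a : ℕ)
  /-- `memory[a] := b` -/
  | store (a b : ℕ)
  /-- report the content of `a` -/
  | report (a : ℕ)
  | skip
  | seq (P Q : Program)
  /-- if `a ≠ 0` then `P` else `Q` -/
  | branch (a : ℕ) (P Q : Program)
  /-- while `a ≠ 0` do `P` -/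
  | loop (a : ℕ) (P : Program)

structure State (w : ℕ) where
  reg : ℕ → BitVec w
  mem : BitVec w → BitVec w
  /-- the words reported so far, in order -/
  out : List (BitVec w)

/-- The state in which register `r` has been set to `x`. -/
def State.setReg {w : ℕ} (s : State w) (r : ℕ) (x : BitVec w) : State w :=
  { s with reg := Function.update s.reg r x }

/-- The content of a cell of a read-only array; cells behind its end contain `0`. -/
def cell {w : ℕ} (A : List (BitVec w)) (a : BitVec w) : BitVec w := A.getD a.toNat 0

/-- `Exec idx pat P s τ s'`: started in state `s`, with the index array `idx` and the pattern array
`pat`, the program `P` halts after exactly `τ` units of time, in state `s'`. -/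
inductive Exec {w : ℕ} (idx pat : List (BitVec w)) : Program → State w → ℕ → State w → Prop
  | const (r v : ℕ) (s : State w) :
      Exec idx pat (.const r v) s 1 (s.setReg r (BitVec.ofNat w v))
  | op (o : BinOp) (r a b : ℕ) (s : State w) :
      Exec idx pat (.op o r a b) s 1 (s.setReg r (o.eval (s.reg a) (s.reg b)))
  | readIndex (r a : ℕ) (s : State w) :
      Exec idx pat (.readIndex r a) s 1 (s.setReg r (cell idx (s.reg a)))
  | readPattern (r a : ℕ) (s : State w) :
      Exec idx pat (.readPattern r a) s 1 (s.setReg r (cell pat (s.reg a)))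
  | load (r a : ℕ) (s : State w) :
      Exec idx pat (.load r a) s 1 (s.setReg r (s.mem (s.reg a)))
  | store (a b : ℕ) (s : State w) :
      Exec idx pat (.store a b) s 1
        { s with mem := Function.update s.mem (s.reg a) (s.reg b) }
  | report (a : ℕ) (s : State w) :
      Exec idx pat (.report a) s 1 { s with out := s.out ++ [s.reg a] }
  | skip (s : State w) : Exec idx pat .skip s 1 s
  | seq {P Q : Program} {s s' s'' : State w} {τ τ' : ℕ} :
      Exec idx pat P s τ s' → Exec idx pat Q s' τ' s'' →
      Exec idx pat (.seq P Q) s (τ + τ') s''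
  | branchTrue {a : ℕ} {P Q : Program} {s s' : State w} {τ : ℕ} :
      s.reg a ≠ 0 → Exec idx pat P s τ s' → Exec idx pat (.branch a P Q) s (τ + 1) s'
  | branchFalse {a : ℕ} {P Q : Program} {s s' : State w} {τ : ℕ} :
      s.reg a = 0 → Exec idx pat Q s τ s' → Exec idx pat (.branch a P Q) s (τ + 1) s'
  | loopFalse {a : ℕ} {P : Program} {s : State w} :
      s.reg a = 0 → Exec idx pat (.loop a P) s 1 s
  | loopTrue {a : ℕ} {P : Program} {s s' s'' : State w} {τ τ' : ℕ} :
      s.reg a ≠ 0 → Exec idx pat P s τ s' → Exec idx pat (.loop a P) s' τ' s'' →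
      Exec idx pat (.loop a P) s (τ + τ' + 1) s''

/-! ### Wildcard indexes -/

/-- The wildcard is presented to the machine as `0`, the character `a` as `a + 1`. -/
def encodePattern (w : ℕ) {σ : ℕ} (p : Pattern σ) : List (BitVec w) :=
  p.map fun x => match x with
    | none => 0
    | some a => BitVec.ofNat w (a.val + 1)

/-- A query starts with the length of the pattern in register `0` and zeros everywhere else. -/
def initState (w len : ℕ) : State w where
  reg := fun r => if r = 0 then BitVec.ofNat w len else 0
  mem := fun _ => 0
  out := []

/-- On the pattern `p`, the program `P` with the index array `idx` halts within time `T` and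
reports every position at which `p` occurs in `t` exactly once, and nothing else. -/
def AnswersQuery {w σ : ℕ} (P : Program) (idx : List (BitVec w)) (t : Text σ) (p : Pattern σ)
    (T : ℝ) : Prop :=
  ∃ (τ : ℕ) (s : State w), Exec idx (encodePattern w p) P (initState w p.length) τ s ∧
    (τ : ℝ) ≤ T ∧ ((s.out.map BitVec.toNat : List ℕ) : Multiset ℕ) = (occurrences t p).val

/-- The array `idx` of `w`-bit words, queried by the program `P`, is a `k`-bounded wildcard index
for `t` with query time at most `T`: all patterns with at least one character and at most `k`
wildcards (and whose length fits in a word) are answered within time `T p`. The space used by the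
index is the number `idx.length` of its words. -/
def IsBoundedWildcardIndex {w σ : ℕ} (k : ℕ) (P : Program) (idx : List (BitVec w)) (t : Text σ)
    (T : Pattern σ → ℝ) : Prop :=
  ∀ p : Pattern σ, 0 < numChars p → numWild p ≤ k → p.length < 2 ^ w →
    AnswersQuery P idx t p (T p)

end WildcardIndexing

/-! The new array contains the given index and, when `G ≥ 1`, a search tree for short patterns; the
length of the pattern decides which one is used. Let `L = ⌊G⌋`. If a pattern has more than `L`
symbols, then `G ≤ m + j ≤ F + j`, so `F + G + occ` is at most twice `F + j + occ` and the given
index is already fast enough. Running its program inside a larger array costs a constant factor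
(`runs_relocate`, `answers_of_long`).

Patterns of at most `L` symbols are searched in a compressed trie of the suffixes, cut off at depth
`L`. Every branching node, except at depth `0`, has one more subtree, for the wildcard: it holds all
suffixes below the node that have some character there, whatever it is, and has one level of
wildcards less. A wildcard inside an edge needs no subtree, since the suffixes below agree there.
Hence a suffix is copied only at its branching depths.

There are at most `H = min L h` of these in each trie. The bound `L` comes from the cut. The bound
`h` holds because the suffixes in a wildcard subtree, read from its root on, are again suffixes of
`t`, so that branching depths give vertices on one path of the suffix tree. In the topmost trie only
`H - 1` depths count: leading wildcards are stripped from the pattern, so no wildcard is read at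
depth `0`. A start therefore accounts for `1 + (H - 1)(1 + H + ⋯ + H^(k-1)) = H^k` entries, and
`build_tree` obtains `O(n H^k)` words. The children of a node are found by perfect hashing in space
linear in their number (`exists_dictionary`).

The search reads only the symbols at the depths stored in the nodes. The suffixes at the final node
agree at all skipped positions, so either all of them match or none does, and a single comparison
with the text decides (`runs_walk`, `runs_output`). Among the listed starts, at most as many as
there are stripped wildcards lie too close to the beginning of the text to give an occurrence
(`length_le_occ`). The time is thus `O(m + j + occ)`. -/

namespace WildcardIndexing

/-! ### Multiply-shift hashing -/

/-- The multiply-shift hash value of `x` with multiplier `a`; it has `l` bits. -/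
def mulShift (w l a x : ℕ) : ℕ := a * x % 2 ^ w / 2 ^ (w - l)

lemma mulShift_lt {w l : ℕ} (hl : l ≤ w) (a x : ℕ) : mulShift w l a x < 2 ^ l := by
  unfold mulShift
  apply Nat.div_lt_of_lt_mul
  rw [← pow_add, Nat.sub_add_cancel hl]
  exact Nat.mod_lt _ (by positivity)

/-- Two numbers in the same interval of length `R` differ by less than `R`. The difference may be
negative, so its residue modulo `M` is close to `0` or close to `M`. -/
lemma near_of_div_eq {M R X Y D : ℕ} (hX : X < M) (hY : Y < M) (hD : D < M) (hR : 0 < R)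
    (h : X / R = Y / R) (hXY : X ≡ Y + D [MOD M]) : D < R ∨ M < D + R := by
  have h1 := Nat.div_add_mod X R
  have h2 := Nat.div_add_mod Y R
  have h3 := Nat.mod_lt X hR
  have h4 := Nat.mod_lt Y hR
  rw [h] at h1
  rcases lt_or_ge (Y + D) M with h5 | h5
  · have : X = Y + D := by
      have := hXY
      rwa [Nat.ModEq, Nat.mod_eq_of_lt hX, Nat.mod_eq_of_lt h5] at this
    left; omega
  · have : X = Y + D - M := by
      have := hXY
      rw [Nat.ModEq, Nat.mod_eq_of_lt hX, Nat.mod_eq_sub_mod h5,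
        Nat.mod_eq_of_lt (by omega)] at this
      exact this
    right; omega

/-- The product modulo `2 ^ w` is `2 ^ s` times an odd residue `v` modulo `2 ^ (w - s)`. If `w - l ≤
s`, no odd `v` is close enough to `0`. Otherwise `2 ^ (w - l - s)` odd values of `v` are admissible,
and each of them comes from at most `2 ^ s` multipliers. -/
lemma card_collision_aux {w l s z : ℕ} (hl : 1 ≤ l) (hlw : l ≤ w) (hs : s < w) (hz : Odd z) :
    ((Finset.range (2 ^ (w - 1))).filter (fun a =>
      ((2 * a + 1) * (2 ^ s * z)) % 2 ^ w < 2 ^ (w - l) ∨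
      2 ^ w < ((2 * a + 1) * (2 ^ s * z)) % 2 ^ w + 2 ^ (w - l))).card ≤ 2 ^ (w - l) := by
  obtain ⟨e, rfl⟩ : ∃ e, w = s + (e + 1) := ⟨w - s - 1, by omega⟩
  set N := 2 ^ (e + 1) with hN
  have hM : 2 ^ (s + (e + 1)) = 2 ^ s * N := pow_add _ _ _
  have hD : ∀ a, ((2 * a + 1) * (2 ^ s * z)) % 2 ^ (s + (e + 1))
      = 2 ^ s * (((2 * a + 1) * z) % N) := by
    intro a
    rw [hM, ← Nat.mul_mod_mul_left]; congr 1; ring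
  have hodd : ∀ a, ((2 * a + 1) * z) % N % 2 = 1 := by
    intro a
    rw [Nat.mod_mod_of_dvd _ (by rw [hN]; exact dvd_pow_self 2 (by omega))]
    have : Odd ((2 * a + 1) * z) := (odd_two_mul_add_one a).mul hz
    exact Nat.odd_iff.mp this
  rcases le_or_gt (s + (e + 1) - l) s with hr | hr
  · rw [Finset.filter_eq_empty_iff.mpr]
    · simp
    intro a _
    rw [hD, hM, not_or]
    have h1 := hodd a
    set v := ((2 * a + 1) * z) % N with hv
    have hvN : v < N := Nat.mod_lt _ (by positivity)
    have h2 : 2 ^ (s + (e + 1) - l) ≤ 2 ^ s := Nat.pow_le_pow_right (by norm_num) hr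
    constructor
    · have h3 : 2 ^ s * 1 ≤ 2 ^ s * v := Nat.mul_le_mul_left _ (by omega)
      omega
    · have : v + 1 ≤ N := hvN
      have : 2 ^ s * (v + 1) ≤ 2 ^ s * N := Nat.mul_le_mul_left _ this
      rw [mul_add] at this
      omega
  · obtain ⟨m, hm⟩ : ∃ m, s + (e + 1) - l = s + (m + 1) := ⟨s + (e + 1) - l - s - 1, by omega⟩
    rw [hm]
    have hR : 2 ^ (s + (m + 1)) = 2 ^ s * 2 ^ (m + 1) := pow_add _ _ _
    have hmN : 2 ^ (m + 1) * 2 ≤ N := by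
      rw [hN, ← pow_succ]; exact Nat.pow_le_pow_right (by norm_num) (by omega)
    have hN2 : N % 2 = 0 := by rw [hN, pow_succ]; omega
    have hm2 : 2 ^ (m + 1) % 2 = 0 := by rw [pow_succ]; omega
    rw [hR]
    -- The first component is formed by the upper `s` bits of `(2a + 1) z` modulo `2 ^ w`. The
    -- second one encodes the lower part `v`: a cyclic shift makes the two admissible ranges
    -- contiguous, and since `v` is odd, nothing is lost by halving.
    refine le_trans (Finset.card_le_card_of_injOn (t := Finset.range (2 ^ s) ×ˢ
      Finset.range (2 ^ (m + 1))) (fun a =>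
      (((2 * a + 1) * z) % (2 ^ s * N) / N,
        ((((2 * a + 1) * z) % N + 2 ^ (m + 1)) % N) / 2)) ?_ ?_) (by simp)
    · intro a ha
      simp only [Finset.coe_filter, Finset.mem_range, Set.mem_ofPred_eq, hD] at ha
      rw [hM] at ha
      simp only [Finset.coe_product, Set.mem_prod, Finset.mem_coe, Finset.mem_range]
      have h1 := hodd a
      have hvN : ((2 * a + 1) * z) % N < N := Nat.mod_lt _ (by positivity)
      refine ⟨?_, ?_⟩
      · apply Nat.div_lt_of_lt_mul
        rw [mul_comm N]
        exact Nat.mod_lt _ (by positivity)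
      · set v := ((2 * a + 1) * z) % N with hv
        rcases ha.2 with h | h
        · have h : v < 2 ^ (m + 1) := Nat.lt_of_mul_lt_mul_left h
          rw [Nat.mod_eq_of_lt (by omega)]
          omega
        · rw [← mul_add] at h
          have h : N < v + 2 ^ (m + 1) := Nat.lt_of_mul_lt_mul_left h
          rw [Nat.mod_eq_sub_mod h.le, Nat.mod_eq_of_lt (by omega)]
          omega
    · intro a ha a' ha' haa
      simp only [Finset.coe_filter, Finset.mem_range, Set.mem_ofPred_eq] at ha ha'
      simp only [Prod.mk.injEq] at haa
      obtain ⟨h1, h2⟩ := haa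
      have hv : ((2 * a + 1) * z) % N = ((2 * a' + 1) * z) % N := by
        have o1 := hodd a
        have o2 := hodd a'
        have l1 : ((2 * a + 1) * z) % N < N := Nat.mod_lt _ (by positivity)
        have l2 : ((2 * a' + 1) * z) % N < N := Nat.mod_lt _ (by positivity)
        set v := ((2 * a + 1) * z) % N
        set v' := ((2 * a' + 1) * z) % N
        rcases lt_or_ge (v + 2 ^ (m + 1)) N with c1 | c1 <;>
        rcases lt_or_ge (v' + 2 ^ (m + 1)) N with c2 | c2
        · rw [Nat.mod_eq_of_lt c1, Nat.mod_eq_of_lt c2] at h2; omega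
        · rw [Nat.mod_eq_of_lt c1, Nat.mod_eq_sub_mod c2,
            Nat.mod_eq_of_lt (show v' + 2 ^ (m + 1) - N < N by omega)] at h2
          omega
        · rw [Nat.mod_eq_of_lt c2, Nat.mod_eq_sub_mod c1,
            Nat.mod_eq_of_lt (show v + 2 ^ (m + 1) - N < N by omega)] at h2
          omega
        · rw [Nat.mod_eq_sub_mod c2, Nat.mod_eq_of_lt (show v' + 2 ^ (m + 1) - N < N by omega),
            Nat.mod_eq_sub_mod c1, Nat.mod_eq_of_lt (show v + 2 ^ (m + 1) - N < N by omega)] at h2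
          omega
      have hu : ((2 * a + 1) * z) % (2 ^ s * N) = ((2 * a' + 1) * z) % (2 ^ s * N) := by
        rw [← Nat.div_add_mod (((2 * a + 1) * z) % (2 ^ s * N)) N,
          ← Nat.div_add_mod (((2 * a' + 1) * z) % (2 ^ s * N)) N, h1,
          Nat.mod_mod_of_dvd _ (Dvd.intro_left _ rfl), Nat.mod_mod_of_dvd _ (Dvd.intro_left _ rfl),
          hv]
      -- The odd factor `z` is invertible modulo `2 ^ w`, so the product determines the multiplier.
      have hco : Nat.gcd (2 ^ s * N) z = 1 := by
        rw [← hM]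
        exact Nat.Coprime.pow_left _ ((Nat.coprime_two_left).mpr hz)
      have hc := Nat.ModEq.cancel_right_of_coprime hco hu
      have hpow : 2 ^ (s + (e + 1)) = 2 * 2 ^ (s + (e + 1) - 1) := by
        rw [← pow_succ']; congr 1
      rw [← hM, Nat.ModEq, Nat.mod_eq_of_lt (by omega), Nat.mod_eq_of_lt (by omega)] at hc
      omega

/-- Multiply-shift hashing is universal: for two distinct keys, few odd multipliers lead to a
collision. -/
lemma card_collision_le {w l x y : ℕ} (hl : 1 ≤ l) (hlw : l ≤ w) (hx : x < 2 ^ w) (hy : y < 2 ^ w)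
    (hxy : x ≠ y) :
    ((Finset.range (2 ^ (w - 1))).filter (fun a =>
      mulShift w l (2 * a + 1) x = mulShift w l (2 * a + 1) y)).card ≤ 2 ^ (w - l) := by
  wlog h : y < x generalizing x y
  · have := this hy hx hxy.symm (by omega)
    simpa only [eq_comm] using this
  obtain ⟨s, z, hz, hδ⟩ := Nat.exists_eq_two_pow_mul_odd (n := x - y) (by omega)
  have hs : s < w := by
    by_contra hs
    have h1 : 2 ^ w ≤ 2 ^ s := Nat.pow_le_pow_right (by norm_num) (by omega)
    have h2 : 1 ≤ z := hz.pos
    have : 2 ^ s * 1 ≤ 2 ^ s * z := Nat.mul_le_mul_left _ h2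
    omega
  refine le_trans (Finset.card_le_card ?_) (card_collision_aux hl hlw hs hz)
  intro a ha
  simp only [Finset.mem_filter] at ha ⊢
  refine ⟨ha.1, ?_⟩
  refine near_of_div_eq (Nat.mod_lt _ (by positivity)) (Nat.mod_lt _ (by positivity))
    (Nat.mod_lt _ (by positivity)) (by positivity) ha.2 ?_
  have e : (2 * a + 1) * x = (2 * a + 1) * y + (2 * a + 1) * (2 ^ s * z) := by
    rw [← hδ, ← mul_add]; congr 1; omega
  rw [e]
  exact (Nat.mod_modEq _ _).trans (Nat.ModEq.add (Nat.mod_modEq _ _).symm (Nat.mod_modEq _ _).symm)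

/-- The ordered pairs of distinct keys with the same hash value. -/
def collisions (K : Finset ℕ) (f : ℕ → ℕ) : Finset (ℕ × ℕ) :=
  K.offDiag.filter (fun q => f q.1 = f q.2)

/-- Averaging over the `2 ^ (w - 1)` odd multipliers: each ordered pair of distinct keys collides
for at most `2 ^ (w - l)` of them. -/
lemma exists_multiplier {w l : ℕ} (hl : 1 ≤ l) (hlw : l ≤ w) (K : Finset ℕ)
    (hK : ∀ x ∈ K, x < 2 ^ w) :
    ∃ a < 2 ^ w, (collisions K (mulShift w l a)).card * 2 ^ l ≤ 2 * (K.card * K.card - K.card) := by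
  have hsum : ∑ a ∈ Finset.range (2 ^ (w - 1)), (collisions K (mulShift w l (2 * a + 1))).card
      ≤ (K.card * K.card - K.card) * 2 ^ (w - l) := by
    unfold collisions
    simp only [Finset.card_filter]
    rw [Finset.sum_comm, ← Finset.offDiag_card, ← smul_eq_mul]
    refine Finset.sum_le_card_nsmul _ _ _ ?_
    intro q hq
    rw [Finset.mem_offDiag] at hq
    have := card_collision_le hl hlw (hK _ hq.1) (hK _ hq.2.1) hq.2.2
    rwa [Finset.card_filter] at this
  obtain ⟨a, ha, hle⟩ : ∃ a ∈ Finset.range (2 ^ (w - 1)),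
      2 ^ (w - 1) * (collisions K (mulShift w l (2 * a + 1))).card
        ≤ (K.card * K.card - K.card) * 2 ^ (w - l) := by
    by_contra! hcon
    have h1 := Finset.sum_lt_sum_of_nonempty
      (s := Finset.range (2 ^ (w - 1))) ⟨0, by simp⟩ hcon
    rw [Finset.sum_const, Finset.card_range, smul_eq_mul, ← Finset.mul_sum] at h1
    exact absurd (Nat.lt_of_mul_lt_mul_left h1) (not_lt.mpr hsum)
  have hpow : 2 ^ w = 2 * 2 ^ (w - 1) := by
    rw [← pow_succ']; congr 1; omega
  have hpow' : 2 ^ w = 2 ^ (w - l) * 2 ^ l := by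
    rw [← pow_add]; congr 1; omega
  refine ⟨2 * a + 1, ?_, ?_⟩
  · rw [Finset.mem_range] at ha; omega
  · set X := (collisions K (mulShift w l (2 * a + 1))).card
    set Y := K.card * K.card - K.card
    have hp : 0 < 2 ^ w := by positivity
    refine Nat.le_of_mul_le_mul_left ?_ hp
    calc 2 ^ w * (X * 2 ^ l) = 2 * 2 ^ l * (2 ^ (w - 1) * X) := by rw [hpow]; ring
      _ ≤ 2 * 2 ^ l * (Y * 2 ^ (w - l)) := Nat.mul_le_mul_left _ hle
      _ = 2 ^ w * (2 * Y) := by rw [hpow']; ring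

lemma exists_pow_two {d : ℕ} (hd : 0 < d) : ∃ l, 1 ≤ l ∧ d < 2 ^ l ∧ 2 ^ l ≤ 2 * d := by
  refine ⟨Nat.log 2 d + 1, by omega, Nat.lt_pow_succ_log_self (by norm_num) d, ?_⟩
  rw [pow_succ']
  exact Nat.mul_le_mul_left _ (Nat.pow_log_le_self 2 (by omega))

/-! ### Static dictionaries with constant lookup time -/

/-- The content of the cell with address `z`. -/
def rd {w : ℕ} (idx : List (BitVec w)) (z : ℕ) : BitVec w := idx.getD z 0

lemma cell_ofNat {w : ℕ} (idx : List (BitVec w)) {z : ℕ} (hz : z < 2 ^ w) :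
    cell idx (BitVec.ofNat w z) = rd idx z := by
  simp [cell, rd, Nat.mod_eq_of_lt hz]

lemma rd_append_left {w : ℕ} (A B : List (BitVec w)) {z : ℕ} (hz : z < A.length) :
    rd (A ++ B) z = rd A z := by
  unfold rd; exact List.getD_append _ _ _ _ hz

lemma rd_append_right {w : ℕ} (A B : List (BitVec w)) (z : ℕ) :
    rd (A ++ B) (A.length + z) = rd B z := by
  unfold rd
  rw [List.getD_append_right _ _ _ _ (by omega)]
  congr 1; omega

lemma rd_map_range {w N : ℕ} (f : ℕ → BitVec w) {z : ℕ} (hz : z < N) :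
    rd ((List.range N).map f) z = f z := by
  simp [rd, List.getD_eq_getElem?_getD, hz]

/-- Storing a list of items one after the other behind `pre`. -/
lemma alloc_list {ι β W : Type*} [Nonempty β] {M : ℕ} (Q : List W → Prop)
    (hQ : ∀ A B, Q A → Q (A ++ B)) (P : ι → β → List W → Prop)
    (hP : ∀ i b A B, P i b A → P i b (A ++ B)) (cost : ι → ℕ) (l : List ι)
    (h : ∀ i ∈ l, ∀ pre, Q pre → pre.length + cost i ≤ M →
      ∃ ext b, ext.length ≤ cost i ∧ P i b (pre ++ ext)) :
    ∀ pre, Q pre → pre.length + (l.map cost).sum ≤ M →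
      ∃ (ext : List W) (b : ι → β), ext.length ≤ (l.map cost).sum ∧
        ∀ i ∈ l, P i (b i) (pre ++ ext) := by
  classical
  induction l with
  | nil => intro pre _ _; exact ⟨[], fun _ => Classical.arbitrary β, by simp⟩
  | cons i l ih =>
    intro pre hpre hM
    rw [List.map_cons, List.sum_cons] at hM
    obtain ⟨ext, b, h1, h2⟩ := h i (by simp) pre hpre (by omega)
    obtain ⟨ext', b', h3, h4⟩ := ih (fun j hj => h j (by simp [hj])) (pre ++ ext) (hQ _ _ hpre)
      (by rw [List.length_append]; omega)
    refine ⟨ext ++ ext', Function.update b' i b, ?_, ?_⟩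
    · rw [List.length_append, List.map_cons, List.sum_cons]; omega
    intro j hj
    rw [← List.append_assoc]
    rcases eq_or_ne j i with rfl | hji
    · rw [Function.update_self]; exact hP _ _ _ _ h2
    · rw [Function.update_of_ne hji]
      exact h4 j (by simpa [hji] using hj)

/-- Looking up the key `x` in the table at address `base` with the hash function given by the
multiplier `a` and the shift `sh`; each entry is a key and a value. -/
def bucketLookup {w : ℕ} (idx : List (BitVec w)) (a sh base x : BitVec w) : BitVec w :=
  let e := base + BitVec.ofNat w 2 * ((a * x) >>> sh.toNat)
  if cell idx e = x then cell idx (e + BitVec.ofNat w 1) else 0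

/-- Looking up the key `x` in the two-level hash table at address `base`. -/
def lookup {w : ℕ} (idx : List (BitVec w)) (a sh base x : BitVec w) : BitVec w :=
  let e := base + BitVec.ofNat w 3 * ((a * x) >>> sh.toNat)
  bucketLookup idx (cell idx e) (cell idx (e + BitVec.ofNat w 1))
    (cell idx (e + BitVec.ofNat w 2)) x

lemma shift_eq_mulShift {w l a x : ℕ} (ha : a < 2 ^ w) (hx : x < 2 ^ w) :
    (BitVec.ofNat w a * BitVec.ofNat w x) >>> (BitVec.ofNat w (w - l)).toNat
      = BitVec.ofNat w (mulShift w l a x) := by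
  have h0 : w - l < 2 ^ w := lt_of_le_of_lt (Nat.sub_le _ _) Nat.lt_two_pow_self
  apply BitVec.eq_of_toNat_eq
  have h1 : mulShift w l a x < 2 ^ w :=
    lt_of_le_of_lt (Nat.div_le_self _ _) (Nat.mod_lt _ (by positivity))
  rw [BitVec.toNat_ushiftRight, BitVec.toNat_mul, BitVec.toNat_ofNat, BitVec.toNat_ofNat,
    BitVec.toNat_ofNat, BitVec.toNat_ofNat, Nat.mod_eq_of_lt h0, Nat.mod_eq_of_lt ha,
    Nat.mod_eq_of_lt hx, Nat.mod_eq_of_lt h1, Nat.shiftRight_eq_div_pow]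
  rfl

/-- With more than `2 d ^ 2` slots for `d` keys the average number of collisions is below one, so
some multiplier is injective on the keys. At most `4 d ^ 2` slots of two words suffice. The
arbitrary `post` records that words appended later do no harm. -/
lemma exists_bucket {w : ℕ} (K : Finset ℕ) (hK : ∀ x ∈ K, x < 2 ^ w) (f : ℕ → BitVec w)
    (pre : List (BitVec w)) (hM : pre.length + (8 * K.card ^ 2 + 2) ≤ 2 ^ w) :
    ∃ (ext : List (BitVec w)) (q : BitVec w × BitVec w × BitVec w),
      ext.length ≤ 8 * K.card ^ 2 + 2 ∧
      ∀ post, ∀ x, 0 < x → x < 2 ^ w →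
        bucketLookup (pre ++ ext ++ post) q.1 q.2.1 q.2.2 (BitVec.ofNat w x)
          = if x ∈ K then f x else 0 := by
  classical
  have hne : ∀ x, 0 < x → x < 2 ^ w → (0 : BitVec w) ≠ BitVec.ofNat w x := by
    intro x h0 hx h
    have := congrArg BitVec.toNat h
    rw [BitVec.toNat_ofNat, Nat.mod_eq_of_lt hx] at this
    simp at this; omega
  rcases K.eq_empty_or_nonempty with rfl | hKne
  -- With multiplier `0` every key is sent to the single slot, whose stored key `0` differs from all
  -- positive keys.
  · refine ⟨[0, 0], ⟨0, 0, BitVec.ofNat w pre.length⟩, by simp, ?_⟩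
    intro post x h0 hx
    have h1 : cell (pre ++ [0, 0] ++ post) (BitVec.ofNat w pre.length) = 0 := by
      rw [cell_ofNat _ (by simp at hM; omega), rd_append_left _ _ (by simp)]
      exact rd_append_right pre [0, 0] 0
    simp only [bucketLookup]
    rw [show BitVec.ofNat w pre.length + BitVec.ofNat w 2 *
      ((0 * BitVec.ofNat w x) >>> BitVec.toNat 0) = BitVec.ofNat w pre.length by simp, h1,
      if_neg (hne x h0 hx)]
    simp
  · have hb : 0 < K.card := hKne.card_pos
    obtain ⟨l, hl1, hl2, hl3⟩ := exists_pow_two (d := 2 * K.card ^ 2) (by positivity)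
    have hlw : l ≤ w := by
      rw [← Nat.pow_le_pow_iff_right (a := 2) (by norm_num)]; omega
    obtain ⟨a, ha, hcoll⟩ := exists_multiplier hl1 hlw K hK
    have hc0 : (collisions K (mulShift w l a)).card = 0 := by
      by_contra hne
      have : 1 * 2 ^ l ≤ (collisions K (mulShift w l a)).card * 2 ^ l :=
        Nat.mul_le_mul_right _ (by omega)
      have h3 : K.card * K.card = K.card ^ 2 := by ring
      omega
    have hinj : ∀ x ∈ K, ∀ y ∈ K, mulShift w l a x = mulShift w l a y → x = y := by
      intro x hx y hy hxy
      by_contra hne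
      rw [Finset.card_eq_zero] at hc0
      have : (x, y) ∈ collisions K (mulShift w l a) := by simp [collisions, hx, hy, hne, hxy]
      simp [hc0] at this
    -- Even offsets hold keys and odd offsets hold values. An empty slot contains the key `0`, which
    -- is never looked up.
    set g : ℕ → BitVec w := fun z => if h : ∃ x ∈ K, mulShift w l a x = z / 2 then
      (if z % 2 = 0 then BitVec.ofNat w h.choose else f h.choose) else 0 with hg
    refine ⟨(List.range (2 * 2 ^ l)).map g, ⟨BitVec.ofNat w a, BitVec.ofNat w (w - l),
      BitVec.ofNat w pre.length⟩, by simp; omega, ?_⟩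
    intro post x h0 hx
    have hlt := mulShift_lt hlw a x
    have hrd : ∀ z, z < 2 * 2 ^ l →
        rd (pre ++ (List.range (2 * 2 ^ l)).map g ++ post) (pre.length + z) = g z := by
      intro z hz
      rw [rd_append_left _ _ (by simp; omega), rd_append_right, rd_map_range _ hz]
    simp only [bucketLookup]
    rw [shift_eq_mulShift ha hx, ← BitVec.ofNat_mul, ← BitVec.ofNat_add, ← BitVec.ofNat_add,
      cell_ofNat _ (by omega), cell_ofNat _ (by omega), add_assoc, hrd _ (by omega),
      hrd _ (by omega)]
    have e1 : (2 * mulShift w l a x) / 2 = mulShift w l a x := by omega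
    have e2 : (2 * mulShift w l a x + 1) / 2 = mulShift w l a x := by omega
    have e3 : (2 * mulShift w l a x) % 2 = 0 := by omega
    have e4 : ¬ (2 * mulShift w l a x + 1) % 2 = 0 := by omega
    simp only [hg, e1, e2, e3, e4, if_true, if_false]
    by_cases hex : ∃ y ∈ K, mulShift w l a y = mulShift w l a x
    · rw [dif_pos hex, dif_pos hex]
      have hs := hex.choose_spec
      by_cases hxK : x ∈ K
      · have := hinj _ hs.1 _ hxK hs.2
        rw [this, if_pos rfl, if_pos hxK]
      · rw [if_neg hxK, if_neg]
        intro h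
        have := congrArg BitVec.toNat h
        rw [BitVec.toNat_ofNat, BitVec.toNat_ofNat, Nat.mod_eq_of_lt hx,
          Nat.mod_eq_of_lt (hK _ hs.1)] at this
        exact hxK (this ▸ hs.1)
    · rw [dif_neg hex, dif_neg hex, if_neg (hne x h0 hx), if_neg]
      exact fun hxK => hex ⟨x, hxK, rfl⟩

/-- Both sides count ordered pairs with equal hash values, the diagonal included. Thus buckets of
quadratic size have linear total size as soon as the number of collisions is linear. -/
lemma sum_sq_fiber (K : Finset ℕ) (h : ℕ → ℕ) (N : ℕ) (hN : ∀ x, h x < N) :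
    ∑ i ∈ Finset.range N, (K.filter (fun x => h x = i)).card ^ 2
      = K.card + (collisions K h).card := by
  have h1 : K.card = ∑ i ∈ Finset.range N, (K.filter (fun x => h x = i)).card :=
    Finset.card_eq_sum_card_fiberwise (fun x _ => by simpa using hN x)
  have h2 : (collisions K h).card = ∑ i ∈ Finset.range N,
      ((collisions K h).filter (fun q => h q.1 = i)).card :=
    Finset.card_eq_sum_card_fiberwise (fun x _ => by simpa using hN x.1)
  rw [h1, h2, ← Finset.sum_add_distrib]
  refine Finset.sum_congr rfl fun i _ => ?_
  have h3 : (collisions K h).filter (fun q => h q.1 = i)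
      = (K.filter (fun x => h x = i)).offDiag := by
    ext ⟨x, y⟩
    simp only [collisions, Finset.mem_filter, Finset.mem_offDiag]
    constructor
    · rintro ⟨⟨⟨hx, hy, hne⟩, he⟩, hi⟩; exact ⟨⟨hx, hi⟩, ⟨hy, he ▸ hi⟩, hne⟩
    · rintro ⟨⟨hx, hi⟩, ⟨hy, he⟩, hne⟩; exact ⟨⟨⟨hx, hy, hne⟩, hi.trans he.symm⟩, hi⟩
  rw [h3, Finset.offDiag_card, sq]
  have := Nat.le_mul_self (K.filter (fun x => h x = i)).card
  omega

/-- A static dictionary with `d` keys needs at most `34 d` words. -/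
lemma exists_dictionary {w : ℕ} (K : Finset ℕ) (hKne : K.Nonempty) (hK : ∀ x ∈ K, x < 2 ^ w)
    (f : ℕ → BitVec w) (pre : List (BitVec w)) (hM : pre.length + 34 * K.card ≤ 2 ^ w) :
    ∃ (ext : List (BitVec w)) (a sh base : BitVec w),
      ext.length ≤ 34 * K.card ∧
      ∀ post, ∀ x, 0 < x → x < 2 ^ w →
        lookup (pre ++ ext ++ post) a sh base (BitVec.ofNat w x) = if x ∈ K then f x else 0 := by
  classical
  have hd : 0 < K.card := hKne.card_pos
  obtain ⟨l, hl1, hl2, hl3⟩ := exists_pow_two hd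
  have hlw : l ≤ w := by
    rw [← Nat.pow_le_pow_iff_right (a := 2) (by norm_num)]; omega
  obtain ⟨a, ha, hcoll⟩ := exists_multiplier hl1 hlw K hK
  have hc : (collisions K (mulShift w l a)).card ≤ 2 * K.card := by
    by_contra! hlt
    have h1 : (2 * K.card) * K.card ≤ (collisions K (mulShift w l a)).card * 2 ^ l :=
      Nat.mul_le_mul hlt.le hl2.le
    have h2 : 2 * (K.card * K.card) = (2 * K.card) * K.card := by ring
    have h3 := Nat.le_mul_self K.card
    omega
  set Kb : ℕ → Finset ℕ := fun i => K.filter (fun x => mulShift w l a x = i) with hKb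
  have hsq := sum_sq_fiber K (mulShift w l a) (2 ^ l) (mulShift_lt hlw a)
  -- For `d` keys the sum of squares is at most `d + 2 d`, whence `24 d`. With the three words per
  -- bucket in the first-level table and `2 ^ l ≤ 2 d`, the total is at most `24 d + 4 d + 6 d = 34
  -- d`.
  have hcost : ((List.range (2 ^ l)).map (fun i => 8 * (Kb i).card ^ 2 + 2)).sum
      ≤ 24 * K.card + 2 * 2 ^ l := by
    have : ((List.range (2 ^ l)).map (fun i => 8 * (Kb i).card ^ 2 + 2)).sum
        = ∑ i ∈ Finset.range (2 ^ l), (8 * (Kb i).card ^ 2 + 2) := by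
      rw [Finset.sum_eq_multiset_sum]; rfl
    rw [this, Finset.sum_add_distrib, ← Finset.mul_sum, hsq]
    simp
    omega
  obtain ⟨ext, q, hext, hq⟩ := alloc_list (β := BitVec w × BitVec w × BitVec w) (M := 2 ^ w)
    (fun _ => True) (fun _ _ _ => trivial)
    (fun i q A => ∀ post, ∀ x, 0 < x → x < 2 ^ w →
        bucketLookup (A ++ post) q.1 q.2.1 q.2.2 (BitVec.ofNat w x)
          = if x ∈ Kb i then f x else 0)
    (fun i b A B h post => by rw [List.append_assoc]; exact h _)
    (fun i => 8 * (Kb i).card ^ 2 + 2) (List.range (2 ^ l))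
    (fun i _ pre _ hpre =>
      exists_bucket (Kb i) (fun x hx => hK x (Finset.filter_subset _ _ hx)) f pre hpre)
    pre trivial (by omega)
  set g : ℕ → BitVec w := fun z => if z % 3 = 0 then (q (z / 3)).1 else
    if z % 3 = 1 then (q (z / 3)).2.1 else (q (z / 3)).2.2 with hg
  refine ⟨ext ++ (List.range (3 * 2 ^ l)).map g, BitVec.ofNat w a, BitVec.ofNat w (w - l),
    BitVec.ofNat w (pre.length + ext.length), by simp; omega, ?_⟩
  intro post x h0 hx
  have hlt := mulShift_lt hlw a x
  set idx := pre ++ (ext ++ (List.range (3 * 2 ^ l)).map g) ++ post with hidx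
  have hidx' : idx = pre ++ ext ++ ((List.range (3 * 2 ^ l)).map g ++ post) := by simp [hidx]
  have hrd : ∀ z, z < 3 * 2 ^ l → rd idx (pre.length + ext.length + z) = g z := by
    intro z hz
    rw [hidx', ← List.length_append, rd_append_right, rd_append_left _ _ (by simpa using hz),
      rd_map_range _ hz]
  simp only [lookup]
  rw [shift_eq_mulShift ha hx, ← BitVec.ofNat_mul, ← BitVec.ofNat_add, ← BitVec.ofNat_add,
    ← BitVec.ofNat_add, cell_ofNat _ (by omega), cell_ofNat _ (by omega),
    cell_ofNat _ (by omega), add_assoc _ _ 1, add_assoc _ _ 2, hrd _ (by omega),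
    hrd _ (by omega), hrd _ (by omega)]
  have e1 : (3 * mulShift w l a x) / 3 = mulShift w l a x := by omega
  have e2 : (3 * mulShift w l a x + 1) / 3 = mulShift w l a x := by omega
  have e3 : (3 * mulShift w l a x + 2) / 3 = mulShift w l a x := by omega
  have e4 : (3 * mulShift w l a x) % 3 = 0 := by omega
  have e5 : (3 * mulShift w l a x + 1) % 3 = 1 := by omega
  have e6 : (3 * mulShift w l a x + 2) % 3 = 2 := by omega
  simp only [hg, e1, e2, e3, e4, e5, e6]
  norm_num
  rw [hidx', hq _ (by simpa using hlt) _ x h0 hx]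
  simp [hKb]

/-! ### The wildcard tree -/

/-- The words `l` are stored from address `x` on. -/
def Block {w : ℕ} (idx : List (BitVec w)) (x : ℕ) (l : List (BitVec w)) : Prop :=
  ∃ u v, idx = u ++ l ++ v ∧ u.length = x

lemma Block.append {w : ℕ} {idx : List (BitVec w)} {x : ℕ} {l : List (BitVec w)}
    (h : Block idx x l) (post : List (BitVec w)) : Block (idx ++ post) x l := by
  obtain ⟨u, v, rfl, hx⟩ := h
  exact ⟨u, v ++ post, by simp, hx⟩

lemma Block.self {w : ℕ} (pre l : List (BitVec w)) : Block (pre ++ l) pre.length l :=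
  ⟨pre, [], by simp, rfl⟩

lemma Block.of_infix {w : ℕ} {idx : List (BitVec w)} {x : ℕ} {l l' : List (BitVec w)}
    (h : Block idx x l) (hl : l' <:+: l) : ∃ x', Block idx x' l' := by
  obtain ⟨u, v, rfl, _⟩ := h
  obtain ⟨p, q, rfl⟩ := hl
  exact ⟨_, u ++ p, q ++ v, by simp, rfl⟩

lemma Block.length_le {w : ℕ} {idx : List (BitVec w)} {x : ℕ} {l : List (BitVec w)}
    (h : Block idx x l) : x + l.length ≤ idx.length := by
  obtain ⟨u, v, rfl, rfl⟩ := h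
  simp

lemma Block.rd_eq {w : ℕ} {idx : List (BitVec w)} {x : ℕ} {l : List (BitVec w)}
    (h : Block idx x l) {i : ℕ} (hi : i < l.length) : rd idx (x + i) = l[i] := by
  obtain ⟨u, v, rfl, rfl⟩ := h
  rw [List.append_assoc, rd_append_right, rd_append_left _ _ hi]
  simp [rd, hi]

/-- The suffixes that start in `A` agree at the depths in `[d, e)`. -/
def Agree {σ : ℕ} (t : Text σ) (A : Finset ℕ) (d e : ℕ) : Prop :=
  ∀ s ∈ A, ∀ s' ∈ A, ∀ i, d ≤ i → i < e → t[s + i]? = t[s' + i]?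

/-- The starts in `A` whose suffix has the character `a` at depth `d`. -/
def childSet {σ : ℕ} (t : Text σ) (A : Finset ℕ) (d : ℕ) (a : Fin σ) : Finset ℕ :=
  A.filter (fun s => t[s + d]? = some a)

/-- The starts in `A` whose suffix has a character at depth `d`. -/
def starSet {σ : ℕ} (t : Text σ) (A : Finset ℕ) (d : ℕ) : Finset ℕ :=
  A.filter (fun s => s + d < t.length)

/-- The list `ℓ` of the elements of `A` is stored from address `lo` on. -/
structure Listing {w : ℕ} (idx : List (BitVec w)) (lo : ℕ) (ℓ : List ℕ) (A : Finset ℕ) :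
    Prop where
  nodup : ℓ.Nodup
  eq : ℓ.toFinset = A
  block : Block idx lo (ℓ.map (BitVec.ofNat w))

lemma Listing.append {w : ℕ} {idx : List (BitVec w)} {lo : ℕ} {ℓ : List ℕ} {A : Finset ℕ}
    (h : Listing idx lo ℓ A) (post : List (BitVec w)) : Listing (idx ++ post) lo ℓ A :=
  ⟨h.nodup, h.eq, h.block.append post⟩

/-- The words of `idx` represent, from address `x` on, the wildcard tree with `b` levels of
wildcards and depth at most `L` for the suffixes of `t` that start in `A`, below depth `d`. -/
inductive NodeRep {w σ : ℕ} (t : Text σ) (L : ℕ) (idx : List (BitVec w)) :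
    ℕ → ℕ → Finset ℕ → ℕ → Prop
  | leaf {b x : ℕ} {A : Finset ℕ} {d lo : ℕ} {ℓ : List ℕ} :
      Agree t A d L → Listing idx lo ℓ A →
      Block idx x [BitVec.ofNat w (2 ^ w - 1), BitVec.ofNat w lo, BitVec.ofNat w ℓ.length] →
      NodeRep t L idx b x A d
  | node {b x : ℕ} {A : Finset ℕ} {d d' lo : ℕ} {ℓ : List ℕ} {star : ℕ} {a sh base : BitVec w}
      {child : Fin σ → ℕ} :
      d ≤ d' → d' < t.length → Agree t A d d' → Listing idx lo ℓ A →
      Block idx x [BitVec.ofNat w d', BitVec.ofNat w lo, BitVec.ofNat w ℓ.length,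
        BitVec.ofNat w star, a, sh, base] →
      (∀ post, ∀ y, lookup (idx ++ post) a sh base (BitVec.ofNat w (y.val + 1))
        = if (childSet t A d' y).Nonempty then BitVec.ofNat w (child y) else 0) →
      (∀ y, (childSet t A d' y).Nonempty →
        NodeRep t L idx b (child y) (childSet t A d' y) (d' + 1)) →
      (0 < b → 0 < d' → NodeRep t L idx (b - 1) star (starSet t A d') (d' + 1)) →
      NodeRep t L idx b x A d

lemma NodeRep.append {w σ : ℕ} {t : Text σ} {L : ℕ} {idx : List (BitVec w)} {b x : ℕ}
    {A : Finset ℕ} {d : ℕ} (h : NodeRep t L idx b x A d) (post : List (BitVec w)) :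
    NodeRep t L (idx ++ post) b x A d := by
  induction h with
  | leaf h1 h2 h3 => exact .leaf h1 (h2.append _) (h3.append _)
  | node h1 h2 h3 h4 h5 h6 _ _ ih1 ih2 =>
    exact .node h1 h2 h3 (h4.append _) (h5.append _)
      (fun post' y => by rw [List.append_assoc]; exact h6 _ y) ih1 ih2

/-- This is path compression: a record stores only its branching depth, so the same record serves
any higher location on the edge that leads to it. -/
lemma NodeRep.of_agree {w σ : ℕ} {t : Text σ} {L : ℕ} {idx : List (BitVec w)} {b x : ℕ}
    {A : Finset ℕ} {d : ℕ} (h : NodeRep t L idx b x A (d + 1)) (hd : Agree t A d (d + 1)) :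
    NodeRep t L idx b x A d := by
  have key : ∀ e, Agree t A (d + 1) e → Agree t A d e := by
    intro e he s hs s' hs' i h1 h2
    rcases Nat.eq_or_lt_of_le h1 with rfl | h3
    · exact hd s hs s' hs' _ le_rfl (by omega)
    · exact he s hs s' hs' i h3 h2
  cases h with
  | leaf h1 h2 h3 => exact .leaf (key _ h1) h2 h3
  | node h1 h2 h3 h4 h5 h6 h7 h8 =>
    exact .node (by omega) h2 (key _ h3) h4 h5 h6 h7 h8

/-! ### Space accounting for the wildcard tree -/

open Classical in
/-- The depths below `L` at which the suffix that starts at `s + d₀` leaves other suffixes, counted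
from `s`. -/
noncomputable def branchDepths {σ : ℕ} (t : Text σ) (L d₀ s : ℕ) : Finset ℕ :=
  (Finset.range L).filter fun i => d₀ ≤ i ∧ 0 < i ∧ ∃ s', s' + d₀ ≤ t.length ∧
    (∀ e, d₀ ≤ e → e < i → t[s + e]? = t[s' + e]?) ∧ t[s + i]? ≠ t[s' + i]?

/-- The number of branching depths that are at least `d`. -/
noncomputable def branchCount {σ : ℕ} (t : Text σ) (L d₀ d s : ℕ) : ℕ :=
  ((branchDepths t L d₀ s).filter (d ≤ ·)).card

lemma branchCount_succ_le {σ : ℕ} (t : Text σ) (L d₀ d s : ℕ) :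
    branchCount t L d₀ (d + 1) s ≤ branchCount t L d₀ d s := by
  refine Finset.card_le_card fun i hi => ?_
  rw [Finset.mem_filter] at hi ⊢
  exact ⟨hi.1, by omega⟩

lemma branchCount_succ_lt {σ : ℕ} {t : Text σ} {L d₀ d s : ℕ} (h : d ∈ branchDepths t L d₀ s) :
    branchCount t L d₀ (d + 1) s + 1 ≤ branchCount t L d₀ d s := by
  refine Finset.card_lt_card ?_
  rw [Finset.ssubset_iff]
  refine ⟨d, by simp, fun i hi => ?_⟩
  rw [Finset.mem_insert, Finset.mem_filter] at hi
  rw [Finset.mem_filter]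
  rcases hi with rfl | hi
  · exact ⟨h, le_rfl⟩
  · exact ⟨hi.1, by omega⟩

lemma branchCount_le {σ : ℕ} (t : Text σ) (L d₀ d s : ℕ) :
    branchCount t L d₀ d s ≤ (branchDepths t L d₀ s).card :=
  Finset.card_le_card (Finset.filter_subset _ _)

/-- An upper bound for the number of words of the trie below `(A, d)`; the weight `g` accounts for
the wildcard subtrees. -/
noncomputable def trieCost {σ : ℕ} (t : Text σ) (L g d₀ d : ℕ) (A : Finset ℕ) : ℕ :=
  94 * A.card + 95 * g * ∑ s ∈ A, branchCount t L d₀ d s - 87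

lemma card_eq_children {σ : ℕ} (t : Text σ) (A : Finset ℕ) (d : ℕ) (f : ℕ → ℕ) :
    ∑ s ∈ A, f s = ∑ a ∈ Finset.univ.filter (fun a => (childSet t A d a).Nonempty),
        ∑ s ∈ childSet t A d a, f s
      + ∑ s ∈ A.filter (fun s => t[s + d]? = none), f s := by
  have h1 : ∑ a ∈ Finset.univ.filter (fun a => (childSet t A d a).Nonempty),
        ∑ s ∈ childSet t A d a, f s = ∑ a : Fin σ, ∑ s ∈ childSet t A d a, f s := by
    refine Finset.sum_subset (Finset.filter_subset _ _) fun a _ ha => ?_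
    rw [Finset.mem_filter, not_and, Finset.not_nonempty_iff_eq_empty] at ha
    rw [ha (Finset.mem_univ _), Finset.sum_empty]
  rw [h1, ← Finset.sum_fiberwise (s := A) (g := fun s => t[s + d]?) (f := f), Fintype.sum_option,
    add_comm]
  rfl

lemma infix_flatMap {α β : Type*} {l : List α} {a : α} (h : a ∈ l) (f : α → List β) :
    f a <:+: l.flatMap f := by
  obtain ⟨l₁, l₂, rfl⟩ := List.append_of_mem h
  exact ⟨l₁.flatMap f, l₂.flatMap f, by simp⟩

/-- An amortized count. The `-87` in `trieCost` is a credit left over by every subtree; each child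
spends `34` of it on its dictionary entry, and the remaining `53` per child pay for the `7` words of
the record and restore the credit. The wildcard subtree is paid for by the branching depth `d`,
which every start in `A` uses up here. -/
lemma trieCost_node {σ : ℕ} {t : Text σ} {L g d₀ d : ℕ} {A : Finset ℕ}
    (hd : d₀ ≤ d) (hdL : d < L)
    (hs : ∀ s ∈ A, s + d₀ ≤ t.length) (hag : Agree t A d₀ d)
    (hbr : ¬ Agree t A d (d + 1)) (starCost : ℕ)
    (hstar : starCost ≤ if 0 < d then 95 * A.card * g else 0) :
    starCost + ∑ a ∈ Finset.univ.filter (fun a => (childSet t A d a).Nonempty),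
        trieCost t L g d₀ (d + 1) (childSet t A d a)
      + 34 * (Finset.univ.filter (fun a => (childSet t A d a).Nonempty)).card + 7
      ≤ trieCost t L g d₀ d A := by
  set Ch := Finset.univ.filter (fun a => (childSet t A d a).Nonempty) with hCh
  set E := A.filter (fun s => t[s + d]? = none) with hE
  have hbr' : ∃ s ∈ A, ∃ s' ∈ A, t[s + d]? ≠ t[s' + d]? := by
    unfold Agree at hbr
    push Not at hbr
    obtain ⟨s, hs, s', hs', i, h1, h2, h3⟩ := hbr
    obtain rfl : i = d := by omega
    exact ⟨s, hs, s', hs', h3⟩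
  -- At a branching either some suffix ends, or there are two different children and `2 * 53 ≥ 94`.
  -- Here `94 = 87 + 7` and `53 = 87 - 34`.
  have hcount : 94 ≤ 94 * E.card + 53 * Ch.card := by
    obtain ⟨s, hs, s', hs', hne⟩ := hbr'
    have hmemE : ∀ s ∈ A, t[s + d]? = none → 0 < E.card := fun s hs h =>
      Finset.card_pos.mpr ⟨s, Finset.mem_filter.mpr ⟨hs, h⟩⟩
    have hmemC : ∀ s ∈ A, ∀ a, t[s + d]? = some a → a ∈ Ch := fun s hs a h => by
      simp only [hCh, Finset.mem_filter, Finset.mem_univ, true_and]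
      exact ⟨s, by simp [childSet, hs, h]⟩
    rcases h : t[s + d]? with _ | a <;> rcases h' : t[s' + d]? with _ | a'
    · exact absurd (h.trans h'.symm) hne
    · have := hmemE s hs h; omega
    · have := hmemE s' hs' h'; omega
    · have h2 : 1 < Ch.card := Finset.one_lt_card.mpr ⟨a, hmemC s hs a h, a', hmemC s' hs' a' h',
        fun h3 => hne (by rw [h, h', h3])⟩
      omega
  have hcard := card_eq_children t A d (fun _ => 1)
  rw [← Finset.card_eq_sum_ones] at hcard
  simp only [← Finset.card_eq_sum_ones] at hcard
  have hbc := card_eq_children t A d (branchCount t L d₀ (d + 1))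
  have hch : ∑ a ∈ Ch, trieCost t L g d₀ (d + 1) (childSet t A d a) + 87 * Ch.card
      = 94 * ∑ a ∈ Ch, (childSet t A d a).card
        + 95 * g * ∑ a ∈ Ch, ∑ s ∈ childSet t A d a, branchCount t L d₀ (d + 1) s := by
    rw [Finset.mul_sum, Finset.mul_sum, mul_comm 87, ← smul_eq_mul (a := Ch.card),
      ← Finset.sum_const, ← Finset.sum_add_distrib, ← Finset.sum_add_distrib]
    refine Finset.sum_congr rfl fun a ha => ?_
    have : 0 < (childSet t A d a).card := Finset.card_pos.mpr (by simpa [hCh] using ha)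
    unfold trieCost
    omega
  -- If `0 < d`, then `d` is a branching depth of every start in `A`, so each `branchCount` drops by
  -- at least one and releases `95 * g` words.
  have hstar' : starCost + 95 * g * ∑ s ∈ A, branchCount t L d₀ (d + 1) s
      ≤ 95 * g * ∑ s ∈ A, branchCount t L d₀ d s := by
    by_cases h0 : 0 < d
    · rw [if_pos h0] at hstar
      have : ∑ s ∈ A, branchCount t L d₀ (d + 1) s + A.card ≤ ∑ s ∈ A, branchCount t L d₀ d s := by
        rw [Finset.card_eq_sum_ones, ← Finset.sum_add_distrib]
        refine Finset.sum_le_sum fun s hsA => branchCount_succ_lt ?_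
        simp only [branchDepths, Finset.mem_filter, Finset.mem_range]
        refine ⟨hdL, hd, h0, ?_⟩
        obtain ⟨s₁, hs₁, s₂, hs₂, hne⟩ := hbr'
        rcases eq_or_ne (t[s + d]?) (t[s₁ + d]?) with h | h
        · exact ⟨s₂, hs _ hs₂, fun e he1 he2 => hag s hsA s₂ hs₂ e he1 he2, by rwa [h]⟩
        · exact ⟨s₁, hs _ hs₁, fun e he1 he2 => hag s hsA s₁ hs₁ e he1 he2, h⟩
      have h2 := Nat.mul_le_mul_left (95 * g) this
      rw [mul_add] at h2
      have h3 : 95 * A.card * g = 95 * g * A.card := by ring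
      omega
    · rw [if_neg h0] at hstar
      have : ∑ s ∈ A, branchCount t L d₀ (d + 1) s ≤ ∑ s ∈ A, branchCount t L d₀ d s :=
        Finset.sum_le_sum fun s _ => branchCount_succ_le _ _ _ _ _
      have := Nat.mul_le_mul_left (95 * g) this
      omega
  rw [hbc, mul_add] at hstar'
  have hl := congrArg (94 * ·) hcard
  simp only [mul_add] at hl
  unfold trieCost at hch ⊢
  rw [← hCh, ← hE] at hl
  rw [← hCh, ← hE] at hstar'
  omega

/-! ### Construction of the wildcard tree -/

section Build

variable {w σ : ℕ} {t : Text σ} {L : ℕ}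

/-- All nodes of one trie, wildcard subtrees excepted, share one list of starts: the list of a node
is the concatenation of the lists of its children and of the suffixes that end there, so that each
subtree owns a contiguous block. Therefore `ℓ` is chosen before the storage: it must already be
stored when the records that point into it are written. The induction is on the number of depths
left before the cut `L`. -/
lemma build_trie (hσ : σ < 2 ^ w) {b g : ℕ}
    (hstar : 0 < b → ∀ (A : Finset ℕ) (d : ℕ), A.Nonempty → (∀ s ∈ A, s + d ≤ t.length) → 0 < d →
      ∀ pre : List (BitVec w), pre.length + 95 * A.card * g ≤ 2 ^ w →
        ∃ ext x, ext.length ≤ 95 * A.card * g ∧ NodeRep t L (pre ++ ext) (b - 1) x A d)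
    (fuel : ℕ) : ∀ (d₀ d : ℕ) (A : Finset ℕ), L ≤ d + fuel → d₀ ≤ d → A.Nonempty →
      (∀ s ∈ A, s + d₀ ≤ t.length) → Agree t A d₀ d →
      ∃ ℓ : List ℕ, ℓ.Nodup ∧ ℓ.toFinset = A ∧
        ∀ (pre : List (BitVec w)) (lo : ℕ), Block pre lo (ℓ.map (BitVec.ofNat w)) →
          pre.length + trieCost t L g d₀ d A ≤ 2 ^ w →
          ∃ ext x, ext.length ≤ trieCost t L g d₀ d A ∧ NodeRep t L (pre ++ ext) b x A d := by
  have leafCase : ∀ (d₀ d : ℕ) (A : Finset ℕ), L ≤ d → A.Nonempty →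
      ∃ ℓ : List ℕ, ℓ.Nodup ∧ ℓ.toFinset = A ∧
        ∀ (pre : List (BitVec w)) (lo : ℕ), Block pre lo (ℓ.map (BitVec.ofNat w)) →
          pre.length + trieCost t L g d₀ d A ≤ 2 ^ w →
          ∃ ext x, ext.length ≤ trieCost t L g d₀ d A ∧ NodeRep t L (pre ++ ext) b x A d := by
    intro d₀ d A hL hA
    refine ⟨A.toList, A.nodup_toList, A.toList_toFinset, fun pre lo hlo _ => ?_⟩
    refine ⟨_, pre.length, ?_, NodeRep.leaf (fun s _ s' _ i h1 h2 => by omega)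
      ⟨A.nodup_toList, A.toList_toFinset, hlo.append _⟩ (Block.self _ _)⟩
    have := hA.card_pos
    unfold trieCost
    simp only [List.length_cons, List.length_nil]
    omega
  induction fuel with
  | zero => intro d₀ d A hL _ hA _ _; exact leafCase d₀ d A hL hA
  | succ fuel ih =>
    intro d₀ d A hL hd hA hs hag
    rcases le_or_gt L d with hLd | hdL
    · exact leafCase d₀ d A hLd hA
    -- Without a branching at depth `d` no record is written and the descent continues.
    by_cases hbr : Agree t A d (d + 1)
    · obtain ⟨ℓ, h1, h2, h3⟩ := ih d₀ (d + 1) A (by omega) (by omega) hA hs (by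
        intro s hs s' hs' i h1 h2
        rcases Nat.lt_succ_iff_lt_or_eq.mp h2 with h3 | rfl
        · exact hag s hs s' hs' i h1 h3
        · exact hbr s hs s' hs' _ le_rfl (by omega))
      have hc : trieCost t L g d₀ (d + 1) A ≤ trieCost t L g d₀ d A := by
        have : ∑ s ∈ A, branchCount t L d₀ (d + 1) s ≤ ∑ s ∈ A, branchCount t L d₀ d s :=
          Finset.sum_le_sum fun s _ => branchCount_succ_le _ _ _ _ _
        have := Nat.mul_le_mul_left (95 * g) this
        unfold trieCost
        omega
      refine ⟨ℓ, h1, h2, fun pre lo hlo hpre => ?_⟩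
      obtain ⟨ext, x, h4, h5⟩ := h3 pre lo hlo (by omega)
      exact ⟨ext, x, by omega, h5.of_agree hbr⟩
    · have ihc : ∀ a : Fin σ, ∃ ℓ : List ℕ, (childSet t A d a).Nonempty →
          ℓ.Nodup ∧ ℓ.toFinset = childSet t A d a ∧
          ∀ (pre : List (BitVec w)) (lo : ℕ), Block pre lo (ℓ.map (BitVec.ofNat w)) →
          pre.length + trieCost t L g d₀ (d + 1) (childSet t A d a) ≤ 2 ^ w →
          ∃ ext x, ext.length ≤ trieCost t L g d₀ (d + 1) (childSet t A d a) ∧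
            NodeRep t L (pre ++ ext) b x (childSet t A d a) (d + 1) := by
        intro a
        by_cases hne : (childSet t A d a).Nonempty
        · obtain ⟨ℓ, h⟩ := ih d₀ (d + 1) (childSet t A d a) (by omega) (by omega) hne
            (fun s h => hs s (Finset.filter_subset _ _ h)) (by
              intro s hs s' hs' i h1 h2
              simp only [childSet, Finset.mem_filter] at hs hs'
              rcases Nat.lt_succ_iff_lt_or_eq.mp h2 with h3 | rfl
              · exact hag s hs.1 s' hs'.1 i h1 h3
              · rw [hs.2, hs'.2])
          exact ⟨ℓ, fun _ => h⟩
        · exact ⟨[], fun h => absurd h hne⟩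
      choose ℓc hℓc using ihc
      set Ch := Finset.univ.filter (fun a => (childSet t A d a).Nonempty) with hCh
      have memCh : ∀ a, a ∈ Ch ↔ (childSet t A d a).Nonempty := by simp [hCh]
      set E := A.filter (fun s => t[s + d]? = none) with hE
      set ℓ := Ch.toList.flatMap ℓc ++ E.toList with hℓ
      have memc : ∀ a ∈ Ch, ∀ s, s ∈ ℓc a ↔ s ∈ A ∧ t[s + d]? = some a := by
        intro a ha s
        rw [← List.mem_toFinset, (hℓc a ((memCh a).mp ha)).2.1, childSet, Finset.mem_filter]
      have hnodup : ℓ.Nodup := by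
        rw [hℓ, List.nodup_append]
        refine ⟨?_, E.nodup_toList, ?_⟩
        · rw [List.nodup_flatMap]
          refine ⟨fun a ha => (hℓc a ((memCh a).mp (by simpa using ha))).1, ?_⟩
          refine List.Nodup.pairwise_of_forall_ne Ch.nodup_toList ?_
          intro a ha a' ha' hne s h1 h2
          rw [memc a (by simpa using ha)] at h1
          rw [memc a' (by simpa using ha')] at h2
          exact hne (Option.some.inj (h1.2.symm.trans h2.2))
        · intro s h1 s' h2 hss
          subst hss
          obtain ⟨a, ha, h3⟩ := List.mem_flatMap.mp h1
          rw [memc a (by simpa using ha)] at h3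
          rw [Finset.mem_toList, hE, Finset.mem_filter, h3.2] at h2
          exact absurd h2.2 (by simp)
      have htoF : ℓ.toFinset = A := by
        ext s
        rw [List.mem_toFinset, hℓ, List.mem_append, List.mem_flatMap, Finset.mem_toList, hE,
          Finset.mem_filter]
        constructor
        · rintro (⟨a, ha, h⟩ | h)
          · exact ((memc a (by simpa using ha) s).mp h).1
          · exact h.1
        · intro hsA
          rcases h : t[s + d]? with _ | a
          · exact Or.inr ⟨hsA, rfl⟩
          · have ha : a ∈ Ch := (memCh a).mpr ⟨s, by simp [childSet, hsA, h]⟩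
            exact Or.inl ⟨a, by simpa using ha, (memc a ha s).mpr ⟨hsA, h⟩⟩
      refine ⟨ℓ, hnodup, htoF, fun pre lo hlo hpre => ?_⟩
      have hbr' : ∃ s ∈ A, s + d < t.length := by
        unfold Agree at hbr
        push Not at hbr
        obtain ⟨s, hsA, s', hsA', i, h1, h2, h3⟩ := hbr
        obtain rfl : i = d := by omega
        by_contra! hcon
        have e1 := hcon s hsA
        have e2 := hcon s' hsA'
        rw [List.getElem?_eq_none e1, List.getElem?_eq_none e2] at h3
        exact h3 rfl
      obtain ⟨s₀, hs₀, hs₀'⟩ := hbr'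
      have hChne : Ch.Nonempty := by
        refine ⟨t[s₀ + d], (memCh _).mpr ⟨s₀, ?_⟩⟩
        simp [childSet, hs₀, List.getElem?_eq_getElem hs₀']
      have hstarle : (starSet t A d).card ≤ A.card := Finset.card_le_card (Finset.filter_subset _ _)
      -- the subtree of the wildcard
      obtain ⟨ext₁, star, hc₁, hr₁⟩ : ∃ (ext : List (BitVec w)) (x : ℕ),
          (ext.length ≤ if 0 < b ∧ 0 < d then 95 * A.card * g else 0) ∧
          (0 < b → 0 < d → NodeRep t L (pre ++ ext) (b - 1) x (starSet t A d) (d + 1)) := by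
        by_cases hbd : 0 < b ∧ 0 < d
        · have hle := trieCost_node (g := g) hd hdL hs hag hbr (95 * A.card * g)
            (by rw [if_pos hbd.2])
          have hmono : 95 * (starSet t A d).card * g ≤ 95 * A.card * g :=
            Nat.mul_le_mul_right _ (Nat.mul_le_mul_left _ hstarle)
          obtain ⟨ext, x, h1, h2⟩ := hstar hbd.1 (starSet t A d) (d + 1)
            ⟨s₀, by simp [starSet, hs₀, hs₀']⟩
            (fun s hs => by
              have := (Finset.mem_filter.mp hs).2; omega) (by omega) pre (by omega)
          exact ⟨ext, x, by rw [if_pos hbd]; omega, fun _ _ => h2⟩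
        · exact ⟨[], 0, by simp, fun h1 h2 => absurd ⟨h1, h2⟩ hbd⟩
      have hcost := trieCost_node (g := g) hd hdL hs hag hbr ext₁.length (by
        refine hc₁.trans ?_
        by_cases h1 : 0 < b <;> by_cases h2 : 0 < d <;> simp [h1, h2])
      rw [← hCh] at hcost
      -- the subtrees of the characters
      have hsum : (Ch.toList.map fun a => trieCost t L g d₀ (d + 1) (childSet t A d a)).sum
          = ∑ a ∈ Ch, trieCost t L g d₀ (d + 1) (childSet t A d a) := by
        simp
      obtain ⟨ext₂, child, hc₂, hr₂⟩ := alloc_list (M := 2 ^ w)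
        (fun A => Block A lo (ℓ.map (BitVec.ofNat w))) (fun A B h => h.append B)
        (fun (a : Fin σ) (x : ℕ) idx => NodeRep t L idx b x (childSet t A d a) (d + 1))
        (fun i b A B h => h.append B)
        (fun a => trieCost t L g d₀ (d + 1) (childSet t A d a)) Ch.toList
        (fun a ha pre hpre hlen => by
          have ha : a ∈ Ch := by simpa using ha
          obtain ⟨lo', hlo'⟩ := hpre.of_infix (l' := (ℓc a).map (BitVec.ofNat w))
            (List.IsInfix.map _ (by
              rw [hℓ]
              exact (infix_flatMap (by simpa using ha) ℓc).trans
                (List.prefix_append _ _).isInfix))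
          exact (hℓc a ((memCh a).mp ha)).2.2 pre lo' hlo' hlen)
        (pre ++ ext₁) (hlo.append _) (by rw [hsum, List.length_append]; omega)
      rw [hsum] at hc₂
      -- the dictionary
      set K : Finset ℕ := Ch.image (fun a => a.val + 1) with hK
      have hKcard : K.card ≤ Ch.card := Finset.card_image_le
      obtain ⟨ext₃, ma, sh, base, hc₃, hr₃⟩ := exists_dictionary K (hChne.image _)
        (fun x hx => by
          obtain ⟨a, _, rfl⟩ := Finset.mem_image.mp hx
          have := a.isLt; omega)
        (fun x => if h : x - 1 < σ then BitVec.ofNat w (child ⟨x - 1, h⟩) else 0)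
        (pre ++ ext₁ ++ ext₂) (by simp only [List.length_append]; omega)
      -- The record comes last, when the addresses of the subtrees and the parameters of the
      -- dictionary are known.
      refine ⟨ext₁ ++ (ext₂ ++ (ext₃ ++ [BitVec.ofNat w d, BitVec.ofNat w lo,
        BitVec.ofNat w ℓ.length, BitVec.ofNat w star, ma, sh, base])),
        (pre ++ ext₁ ++ ext₂ ++ ext₃).length, ?_, ?_⟩
      · simp only [List.length_append, List.length_cons, List.length_nil]
        omega
      simp only [← List.append_assoc]
      refine NodeRep.node (child := child) le_rfl (by omega) (fun s _ s' _ i h1 h2 => by omega)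
        ⟨hnodup, htoF, (((hlo.append _).append _).append _).append _⟩ (Block.self _ _) ?_ ?_ ?_
      · intro post y
        have hy := y.isLt
        rw [List.append_assoc, hr₃ _ _ (by omega) (by omega)]
        have : (y.val + 1 ∈ K) ↔ (childSet t A d y).Nonempty := by
          rw [← memCh, hK, Finset.mem_image]
          constructor
          · rintro ⟨a, ha, h⟩
            have : a = y := Fin.ext (by omega)
            exact this ▸ ha
          · exact fun h => ⟨y, h, rfl⟩
        simp [this]
      · intro y hy
        exact ((hr₂ y (by simpa using (memCh y).mpr hy)).append _).append _
      · intro h1 h2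
        exact (((hr₁ h1 h2).append _).append _).append _

/-- The number of leaves of all tries of a wildcard tree of height `H` with fewer than `b`
wildcards on each path, per suffix. -/
def geomSum (H b : ℕ) : ℕ := ∑ i ∈ Finset.range b, H ^ i

lemma geomSum_succ (H b : ℕ) : geomSum H (b + 1) = 1 + H * geomSum H b := by
  unfold geomSum
  rw [geom_sum_succ]; ring

/-- A start is listed once in the trie itself and is copied into at most `H` wildcard subtrees of
one level less, which is the recursion `geomSum_succ`. The constant `95` consists of the `94` of
`trieCost` and one word for the entry of the list. -/
lemma build_subtree (hσ : σ < 2 ^ w) {H : ℕ}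
    (hH : ∀ d₀ s, 0 < d₀ → s + d₀ ≤ t.length → (branchDepths t L d₀ s).card ≤ H) (b : ℕ) :
    ∀ (A : Finset ℕ) (d : ℕ), A.Nonempty → (∀ s ∈ A, s + d ≤ t.length) → 0 < d →
      ∀ pre : List (BitVec w), pre.length + 95 * A.card * geomSum H (b + 1) ≤ 2 ^ w →
        ∃ ext x, ext.length ≤ 95 * A.card * geomSum H (b + 1) ∧
          NodeRep t L (pre ++ ext) b x A d := by
  induction b with
  | zero =>
    intro A d hA hs hd pre hpre
    obtain ⟨ℓ, h1, h2, h3⟩ := build_trie (w := w) (t := t) (L := L) (g := 0) (b := 0) hσ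
      (fun h => absurd h (by omega)) L d d A (by omega) le_rfl hA hs
      (fun s _ s' _ i h1 h2 => by omega)
    have hlen : ℓ.length = A.card := by rw [← h2, List.toFinset_card_of_nodup h1]
    have hc : trieCost t L 0 d d A ≤ 94 * A.card := by unfold trieCost; omega
    rw [geomSum_succ] at *
    simp only [geomSum, Finset.range_zero, Finset.sum_empty, mul_zero, add_zero, mul_one] at *
    obtain ⟨ext, x, h4, h5⟩ := h3 (pre ++ ℓ.map (BitVec.ofNat w)) pre.length (Block.self _ _)
      (by simp only [List.length_append, List.length_map]; omega)
    refine ⟨ℓ.map (BitVec.ofNat w) ++ ext, x, ?_, by rwa [← List.append_assoc]⟩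
    simp only [List.length_append, List.length_map]; omega
  | succ b ih =>
    intro A d hA hs hd pre hpre
    obtain ⟨ℓ, h1, h2, h3⟩ := build_trie (w := w) (t := t) (L := L) (b := b + 1) hσ
      (fun _ => ih) L d d A (by omega) le_rfl hA hs
      (fun s _ s' _ i h1 h2 => by omega)
    have hlen : ℓ.length = A.card := by rw [← h2, List.toFinset_card_of_nodup h1]
    have hb : ∑ s ∈ A, branchCount t L d d s ≤ A.card * H := by
      rw [← smul_eq_mul]
      exact Finset.sum_le_card_nsmul _ _ _ fun s hsA =>
        (branchCount_le _ _ _ _ _).trans (hH d s hd (hs s hsA))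
    have hc : A.card + trieCost t L (geomSum H (b + 1)) d d A
        ≤ 95 * A.card * geomSum H (b + 1 + 1) := by
      have h6 := Nat.mul_le_mul_left (95 * geomSum H (b + 1)) hb
      have h7 : 95 * A.card * geomSum H (b + 1 + 1)
          = 95 * A.card + 95 * geomSum H (b + 1) * (A.card * H) := by
        rw [geomSum_succ H (b + 1)]; ring
      have := hA.card_pos
      unfold trieCost
      omega
    obtain ⟨ext, x, h4, h5⟩ := h3 (pre ++ ℓ.map (BitVec.ofNat w)) pre.length (Block.self _ _)
      (by simp only [List.length_append, List.length_map]; omega)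
    refine ⟨ℓ.map (BitVec.ofNat w) ++ ext, x, ?_, by rwa [← List.append_assoc]⟩
    simp only [List.length_append, List.length_map]; omega

/-- The wildcard tree of a text of length `n` with `k` levels of wildcards and height `H` needs
`O (n H ^ k)` words. -/
lemma build_tree (hσ : σ < 2 ^ w) {H : ℕ} (hH1 : 1 ≤ H)
    (hH : ∀ d₀ s, 0 < d₀ → s + d₀ ≤ t.length → (branchDepths t L d₀ s).card ≤ H)
    (hH0 : ∀ s ≤ t.length, (branchDepths t L 0 s).card ≤ H - 1) (ht : t ≠ []) (k : ℕ)
    (pre : List (BitVec w)) (hpre : pre.length + 95 * t.length * H ^ k ≤ 2 ^ w) :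
    ∃ ext x, ext.length ≤ 95 * t.length * H ^ k ∧
      NodeRep t L (pre ++ ext) k x (Finset.range t.length) 0 := by
  have hn : 0 < t.length := List.length_pos_iff.mpr ht
  obtain ⟨ℓ, h1, h2, h3⟩ := build_trie (w := w) (t := t) (L := L) (b := k) (g := geomSum H k) hσ
    (fun hk A d hA hs hd pre hpre => by
      obtain ⟨k, rfl⟩ : ∃ k', k = k' + 1 := ⟨k - 1, by omega⟩
      exact build_subtree hσ hH k A d hA hs hd pre hpre)
    L 0 0 (Finset.range t.length) (by omega) le_rfl (by simpa using ht)
    (fun s hs => by simpa using (Finset.mem_range.mp hs).le)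
    (fun s _ s' _ i h1 h2 => by omega)
  have hlen : ℓ.length = t.length := by
    rw [← List.toFinset_card_of_nodup h1, h2, Finset.card_range]
  have hb : ∑ s ∈ Finset.range t.length, branchCount t L 0 0 s ≤ t.length * (H - 1) := by
    refine (Finset.sum_le_card_nsmul _ _ (H - 1) fun s hsA =>
      (branchCount_le _ _ _ _ _).trans (hH0 s (Finset.mem_range.mp hsA).le)).trans ?_
    simp
  -- Having only `H - 1` branching depths in the topmost trie makes the sum telescope to exactly `H
  -- ^ k`. This matters for `H = 1`, where `geomSum H k` equals `k` and is not bounded by a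
  -- constant.
  have hgeom : H ^ k = 1 + geomSum H k * (H - 1) := by
    obtain ⟨H', rfl⟩ : ∃ H', H = H' + 1 := ⟨H - 1, by omega⟩
    unfold geomSum
    rw [Nat.add_sub_cancel, add_comm 1]
    exact (geom_sum_mul_add H' k).symm
  have hc : t.length + trieCost t L (geomSum H k) 0 0 (Finset.range t.length)
      ≤ 95 * t.length * H ^ k := by
    have h6 := Nat.mul_le_mul_left (95 * geomSum H k) hb
    have h7 : 95 * t.length * H ^ k
        = 95 * t.length + 95 * geomSum H k * (t.length * (H - 1)) := by
      rw [hgeom]; ring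
    unfold trieCost
    rw [Finset.card_range]
    omega
  obtain ⟨ext, x, h4, h5⟩ := h3 (pre ++ ℓ.map (BitVec.ofNat w)) pre.length (Block.self _ _)
    (by simp only [List.length_append, List.length_map]; omega)
  refine ⟨ℓ.map (BitVec.ofNat w) ++ ext, x, ?_, by rwa [← List.append_assoc]⟩
  simp only [List.length_append, List.length_map]; omega

end Build

/-! ### Reasoning about programs -/

/-- Started in state `s`, the program `P` halts within `T` units of time in a state with the
property `Q`. -/
def Runs {w : ℕ} (idx pat : List (BitVec w)) (P : Program) (s : State w) (T : ℕ)
    (Q : State w → Prop) : Prop :=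
  ∃ (τ : ℕ) (s' : State w), Exec idx pat P s τ s' ∧ τ ≤ T ∧ Q s'

section Runs

variable {w : ℕ} {idx pat : List (BitVec w)} {s : State w} {Q : State w → Prop} {T T' : ℕ}
  {P P' : Program}

lemma Runs.mono {Q' : State w → Prop} (h : Runs idx pat P s T Q) (hT : T ≤ T')
    (hQ : ∀ s, Q s → Q' s) : Runs idx pat P s T' Q' := by
  obtain ⟨τ, s', h1, h2, h3⟩ := h
  exact ⟨τ, s', h1, h2.trans hT, hQ _ h3⟩

lemma Runs.seq (h : Runs idx pat P s T fun s' => Runs idx pat P' s' T' Q) :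
    Runs idx pat (.seq P P') s (T + T') Q := by
  obtain ⟨τ, s', h1, h2, τ', s'', h3, h4, h5⟩ := h
  exact ⟨_, s'', .seq h1 h3, by omega, h5⟩

lemma Runs.const {r v : ℕ} (h : Q (s.setReg r (BitVec.ofNat w v))) :
    Runs idx pat (.const r v) s 1 Q := ⟨1, _, .const r v s, le_rfl, h⟩

lemma Runs.op {o : BinOp} {r a b : ℕ} (h : Q (s.setReg r (o.eval (s.reg a) (s.reg b)))) :
    Runs idx pat (.op o r a b) s 1 Q := ⟨1, _, .op o r a b s, le_rfl, h⟩

lemma Runs.readIndex {r a : ℕ} (h : Q (s.setReg r (cell idx (s.reg a)))) :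
    Runs idx pat (.readIndex r a) s 1 Q := ⟨1, _, .readIndex r a s, le_rfl, h⟩

lemma Runs.readPattern {r a : ℕ} (h : Q (s.setReg r (cell pat (s.reg a)))) :
    Runs idx pat (.readPattern r a) s 1 Q := ⟨1, _, .readPattern r a s, le_rfl, h⟩

lemma Runs.report {a : ℕ} (h : Q { s with out := s.out ++ [s.reg a] }) :
    Runs idx pat (.report a) s 1 Q := ⟨1, _, .report a s, le_rfl, h⟩

lemma Runs.skip (h : Q s) : Runs idx pat .skip s 1 Q := ⟨1, _, .skip s, le_rfl, h⟩

lemma Runs.branch {a : ℕ} (h1 : s.reg a ≠ 0 → Runs idx pat P s T Q)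
    (h2 : s.reg a = 0 → Runs idx pat P' s T Q) : Runs idx pat (.branch a P P') s (T + 1) Q := by
  by_cases h : s.reg a = 0
  · obtain ⟨τ, s', h3, h4, h5⟩ := h2 h
    exact ⟨_, s', .branchFalse h h3, by omega, h5⟩
  · obtain ⟨τ, s', h3, h4, h5⟩ := h1 h
    exact ⟨_, s', .branchTrue h h3, by omega, h5⟩

/-- A loop with invariant `I`, whose first argument decreases in every round. -/
lemma Runs.loop {a : ℕ} (I : ℕ → State w → Prop)
    (hI : ∀ m s, I m s → s.reg a ≠ 0 → Runs idx pat P s T fun s' => ∃ m' < m, I m' s')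
    (m : ℕ) (hm : I m s) :
    Runs idx pat (.loop a P) s ((T + 1) * m + 1) fun s' => s'.reg a = 0 ∧ ∃ m, I m s' := by
  induction m using Nat.strong_induction_on generalizing s with
  | _ m ih =>
    by_cases h : s.reg a = 0
    · exact ⟨1, s, .loopFalse h, by omega, h, m, hm⟩
    · obtain ⟨τ, s', h1, h2, m', h3, h4⟩ := hI m s hm h
      obtain ⟨τ', s'', h5, h6, h7⟩ := ih m' h3 h4
      refine ⟨_, s'', .loopTrue h h1 h5, ?_, h7⟩
      have : (T + 1) * (m' + 1) ≤ (T + 1) * m := Nat.mul_le_mul_left _ h3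
      rw [mul_add] at this
      omega

end Runs

/-! ### Running a program on an index that is a part of another one -/

/-- The program `P`, with its registers shifted, on an index that is stored from the address in
register `5` on and whose length is in register `6`. -/
def relocate : Program → Program
  | .const r v => .const (r + 40) v
  | .op o r a b => .op o (r + 40) (a + 40) (b + 40)
  | .readIndex r a => .seq (.op .lt 7 (a + 40) 6)
      (.branch 7 (.seq (.op .add 7 5 (a + 40)) (.readIndex (r + 40) 7)) (.const (r + 40) 0))
  | .readPattern r a => .readPattern (r + 40) (a + 40)
  | .load r a => .load (r + 40) (a + 40)
  | .store a b => .store (a + 40) (b + 40)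
  | .report a => .report (a + 40)
  | .skip => .skip
  | .seq P Q => .seq (relocate P) (relocate Q)
  | .branch a P Q => .branch (a + 40) (relocate P) (relocate Q)
  | .loop a P => .loop (a + 40) (relocate P)

/-- The state `s'` of the relocated program corresponds to the state `s`. -/
structure Simulates {w : ℕ} (base len : BitVec w) (s s' : State w) : Prop where
  reg : ∀ r, s'.reg (r + 40) = s.reg r
  mem : s'.mem = s.mem
  out : s'.out = s.out
  base : s'.reg 5 = base
  len : s'.reg 6 = len

lemma Simulates.setReg {w : ℕ} {base len : BitVec w} {s s' : State w}
    (h : Simulates base len s s') (r : ℕ) (x : BitVec w) :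
    Simulates base len (s.setReg r x) (s'.setReg (r + 40) x) where
  reg r' := by
    simp only [State.setReg, Function.update_apply, Nat.add_right_cancel_iff, h.reg]
  mem := h.mem
  out := h.out
  base := by simp [State.setReg, h.base]
  len := by simp [State.setReg, h.len]

lemma Simulates.setReg_seven {w : ℕ} {base len : BitVec w} {s s' : State w}
    (h : Simulates base len s s') (x : BitVec w) : Simulates base len s (s'.setReg 7 x) where
  reg r' := by simp [State.setReg, h.reg]
  mem := h.mem
  out := h.out
  base := by simp [State.setReg, h.base]
  len := by simp [State.setReg, h.len]

/-- Only reading the index changes: cells behind the end of `idxA` have to read as `0`, although the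
large array may hold other data there, so each access is guarded by a comparison with the length.
This takes at most four steps, and every other instruction is simulated in one. -/
lemma runs_relocate {w : ℕ} {idxA idxB pat : List (BitVec w)} {base len : BitVec w} (hw : 0 < w)
    (hcell : ∀ a : BitVec w,
      cell idxA a = if a.toNat < len.toNat then cell idxB (base + a) else 0)
    {P : Program} {s s₁ : State w} {τ : ℕ} (h : Exec idxA pat P s τ s₁) :
    ∀ s', Simulates base len s s' →
      Runs idxB pat (relocate P) s' (5 * τ) (Simulates base len s₁) := by
  have hone : BitVec.ofNat w 1 ≠ 0 := by
    intro h
    have := congrArg BitVec.toNat h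
    rw [BitVec.toNat_ofNat, Nat.mod_eq_of_lt (Nat.one_lt_two_pow (by omega))] at this
    simp at this
  induction h with
  | const r v s =>
    intro s' h
    exact (Runs.const (h.setReg _ _)).mono (by omega) fun _ => id
  | op o r a b s =>
    intro s' h
    refine (Runs.op ?_).mono (T := 1) (by omega) fun _ => id
    rw [h.reg, h.reg]; exact h.setReg _ _
  | readIndex r a s =>
    intro s' h
    refine (Runs.seq (T := 1) (T' := 3) (Runs.op (Runs.branch (T := 2) ?_ ?_))).mono
      (by omega) fun _ => id
    · intro h1
      refine Runs.seq (T := 1) (T' := 1) (Runs.op (Runs.readIndex ?_))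
      have hlt : (s.reg a).toNat < len.toNat := by
        by_contra hcon
        simp [State.setReg, BinOp.eval, h.reg, h.len, hcon] at h1
      have := ((h.setReg_seven ((BinOp.lt).eval (s'.reg (a + 40)) (s'.reg 6))).setReg_seven
        (base + s.reg a)).setReg r (cell idxA (s.reg a))
      rw [hcell, if_pos hlt] at this ⊢
      simpa [State.setReg, Function.update_apply, h.reg, h.base, BinOp.eval] using this
    · intro h1
      refine (Runs.const ?_).mono (T := 1) (by omega) fun _ => id
      have hlt : ¬ (s.reg a).toNat < len.toNat := by
        intro hcon
        simp only [State.setReg, BinOp.eval, h.reg, h.len, hcon, Function.update_self,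
          if_true] at h1
        exact hone h1
      rw [hcell, if_neg hlt]
      exact (h.setReg_seven _).setReg _ _
  | readPattern r a s =>
    intro s' h
    refine (Runs.readPattern ?_).mono (T := 1) (by omega) fun _ => id
    rw [h.reg]; exact h.setReg _ _
  | load r a s =>
    intro s' h
    refine ⟨1, _, .load _ _ _, by omega, ?_⟩
    rw [h.reg, h.mem]; exact h.setReg _ _
  | store a b s =>
    intro s' h
    refine ⟨1, _, .store _ _ _, by omega, ?_⟩
    exact ⟨h.reg, by simp only [h.reg, h.mem], h.out, h.base, h.len⟩
  | report a s =>
    intro s' h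
    refine ⟨1, _, .report _ _, by omega, ?_⟩
    exact ⟨h.reg, h.mem, by simp only [h.reg, h.out], h.base, h.len⟩
  | skip s =>
    intro s' h
    exact ⟨1, _, .skip _, by omega, h⟩
  | seq _ _ ih1 ih2 =>
    intro s' h
    exact (Runs.seq ((ih1 s' h).mono le_rfl ih2)).mono (by omega) fun _ => id
  | branchTrue hne _ ih =>
    intro s' h
    exact (Runs.branch (fun _ => ih s' h) fun h0 => absurd h0 (by rwa [h.reg])).mono (by omega)
      fun _ => id
  | branchFalse h0 _ ih =>
    intro s' h
    exact (Runs.branch (fun hne => absurd (by rwa [h.reg]) hne) fun _ => ih s' h).mono (by omega)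
      fun _ => id
  | loopFalse h0 =>
    intro s' h
    exact ⟨1, _, .loopFalse (by rwa [h.reg]), by omega, h⟩
  | loopTrue hne _ _ ih1 ih2 =>
    intro s' h
    obtain ⟨τ₁, s₁, h1, h2, h3⟩ := ih1 s' h
    obtain ⟨τ₂, s₂, h4, h5, h6⟩ := ih2 s₁ h3
    exact ⟨_, s₂, .loopTrue (by rwa [h.reg]) h1 h4, by omega, h6⟩

/-! ### Matching a pattern -/

/-- The presentation of a symbol to the machine. -/
def encSym (w : ℕ) {σ : ℕ} : Option (Fin σ) → BitVec w
  | none => 0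
  | some a => BitVec.ofNat w (a.val + 1)

/-- The symbol of `q` at position `i` matches the text at position `s + i`. -/
def MatchAt {σ : ℕ} (t : Text σ) (q : Pattern σ) (s i : ℕ) : Prop :=
  ∃ c, t[s + i]? = some c ∧ (q[i]? = some none ∨ q[i]? = some (some c))

/-- The pattern `q` matches the text from position `s` on, counted from `0`. -/
def Matches {σ : ℕ} (t : Text σ) (q : Pattern σ) (s : ℕ) : Prop :=
  ∀ i < q.length, MatchAt t q s i

/-- The index and the pattern arrays, as seen by a query for `q`, which is the given pattern
without its first `j₀` symbols. -/
structure QueryEnv {w σ : ℕ} (t : Text σ) (q : Pattern σ) (idx pat : List (BitVec w))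
    (j₀ tb : ℕ) : Prop where
  length_le : idx.length ≤ 2 ^ w
  lt : j₀ + q.length < 2 ^ w
  sigma_lt : σ < 2 ^ w
  text_lt : t.length < 2 ^ w
  pattern : ∀ i (h : i < q.length), cell pat (BitVec.ofNat w (j₀ + i)) = encSym w q[i]
  text : Block idx tb (t.map (fun a => BitVec.ofNat w (a.val + 1)) ++ [0])
  dead : Block idx 0 [BitVec.ofNat w (2 ^ w - 1), 0, 0]

/-- The record at address `x` lists starts that either all match or all do not, among them all
starts that match. -/
def Found {w σ : ℕ} (t : Text σ) (q : Pattern σ) (idx : List (BitVec w)) (x : ℕ) : Prop :=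
  ∃ (lo : ℕ) (ℓ : List ℕ), x + 2 < 2 ^ w ∧ rd idx (x + 1) = BitVec.ofNat w lo ∧
    rd idx (x + 2) = BitVec.ofNat w ℓ.length ∧ ℓ.Nodup ∧ Block idx lo (ℓ.map (BitVec.ofNat w)) ∧
    (∀ s ∈ ℓ, s < t.length) ∧ (∀ s < t.length, Matches t q s → s ∈ ℓ) ∧
    ∀ s ∈ ℓ, ∀ s' ∈ ℓ, Matches t q s → Matches t q s'

/-- The situation of a query for `q` at the record at address `x`: it is the dead record, or it
represents a node such that `m` symbols of `q` have not been passed. -/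
def Located {w σ : ℕ} (t : Text σ) (L : ℕ) (q : Pattern σ) (idx : List (BitVec w)) (m x : ℕ) :
    Prop :=
  (x = 0 ∧ ∀ s < t.length, ¬ Matches t q s) ∨
    ∃ b A d, NodeRep t L idx b x A d ∧ numWild (q.drop d) ≤ b ∧ m + d = q.length ∧
      (∀ s ∈ A, s < t.length) ∧ (∀ s < t.length, Matches t q s → s ∈ A) ∧
      ∀ s ∈ A, ∀ s' ∈ A, ∀ i < d, MatchAt t q s i → MatchAt t q s' i

section Steps

variable {w σ : ℕ} {t : Text σ} {L : ℕ} {q : Pattern σ} {idx pat : List (BitVec w)} {j₀ tb : ℕ}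

lemma Block.rd_zero {x : ℕ} {a : BitVec w} {l : List (BitVec w)} (h : Block idx x (a :: l)) :
    rd idx x = a := by
  exact h.rd_eq (i := 0) (by simp)

lemma QueryEnv.rd_dead (h : QueryEnv t q idx pat j₀ tb) :
    (rd idx 0).toNat = 2 ^ w - 1 := by
  have h2 : 0 < 2 ^ w := by positivity
  rw [h.dead.rd_zero, BitVec.toNat_ofNat, Nat.mod_eq_of_lt (by omega)]

/-- Below depth `d` the candidates match alike by the invariant of the search; from `d` on they
carry the same characters up to the end of the pattern. -/
lemma found_of_agree {x lo d e : ℕ} {A : Finset ℕ} {ℓ : List ℕ}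
    (hx : x + 2 < 2 ^ w) (h1 : rd idx (x + 1) = BitVec.ofNat w lo)
    (h2 : rd idx (x + 2) = BitVec.ofNat w ℓ.length)
    (hℓ : Listing idx lo ℓ A) (hag : Agree t A d e) (he : q.length ≤ e)
    (hA : ∀ s ∈ A, s < t.length) (hm : ∀ s < t.length, Matches t q s → s ∈ A)
    (hd : ∀ s ∈ A, ∀ s' ∈ A, ∀ i < d, MatchAt t q s i → MatchAt t q s' i) :
    Found t q idx x := by
  have hmem : ∀ s, s ∈ ℓ ↔ s ∈ A := fun s => by rw [← hℓ.eq, List.mem_toFinset]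
  refine ⟨lo, ℓ, hx, h1, h2, hℓ.nodup, hℓ.block, fun s hs => hA s ((hmem s).mp hs),
    fun s hs h => (hmem s).mpr (hm s hs h), fun s hs s' hs' h i hi => ?_⟩
  rw [hmem] at hs hs'
  rcases lt_or_ge i d with hid | hid
  · exact hd s hs s' hs' i hid (h i hi)
  · obtain ⟨c, h3, h4⟩ := h i hi
    exact ⟨c, by rw [← h3]; exact hag s' hs' s hs i hid (by omega), h4⟩

/-- At a record whose depth is not smaller than the length of the pattern, the search ends. -/
lemma Located.found {m x : ℕ} (h : Located t L q idx m x) (env : QueryEnv t q idx pat j₀ tb)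
    (hL : q.length ≤ L) (hx : q.length ≤ (rd idx x).toNat) : Found t q idx x := by
  rcases h with ⟨rfl, hno⟩ | ⟨b, A, d, hrep, hb, hm, hA, hmA, hd⟩
  · have h1 := env.dead.rd_eq (i := 1) (by simp)
    have h2 := env.dead.rd_eq (i := 2) (by simp)
    have h3 := env.dead.length_le
    have h4 := env.length_le
    simp only [List.length_cons, List.length_nil, List.getElem_cons_succ,
      List.getElem_cons_zero] at h1 h2 h3
    exact ⟨0, [], by omega, h1, h2, by simp, ⟨[], idx, by simp, rfl⟩, by simp,
      fun s hs h => absurd h (hno s hs), by simp⟩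
  · have hlen := env.length_le
    cases hrep with
    | leaf h1 h2 h3 =>
      have h4 := h3.rd_eq (i := 1) (by simp)
      have h5 := h3.rd_eq (i := 2) (by simp)
      have h6 := h3.length_le
      simp only [List.length_cons, List.length_nil, List.getElem_cons_succ,
        List.getElem_cons_zero] at h4 h5 h6
      exact found_of_agree (by omega) h4 h5 h2 h1 hL hA hmA hd
    | node h1 h2 h3 h4 h5 h6 h7 h8 =>
      have h9 := h5.rd_eq (i := 1) (by simp)
      have h10 := h5.rd_eq (i := 2) (by simp)
      have h11 := h5.length_le
      simp only [List.length_cons, List.length_nil, List.getElem_cons_succ,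
        List.getElem_cons_zero] at h9 h10 h11
      have h12 := env.text_lt
      rw [h5.rd_zero, BitVec.toNat_ofNat, Nat.mod_eq_of_lt (by omega)] at hx
      exact found_of_agree (by omega) h9 h10 h4 h3 hx hA hmA hd

lemma numWild_drop_le (q : Pattern σ) {d d' : ℕ} (h : d ≤ d') :
    numWild (q.drop d') ≤ numWild (q.drop d) := by
  obtain ⟨e, rfl⟩ := Nat.exists_eq_add_of_le h
  rw [← List.drop_drop]
  exact (List.drop_sublist _ _).countP_le

/-- The address of the next record, computed from the address of a record and a symbol. -/
def nextAddr (idx : List (BitVec w)) (x : ℕ) (y : BitVec w) : BitVec w :=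
  if y = 0 then rd idx (x + 3) else lookup idx (rd idx (x + 4)) (rd idx (x + 5)) (rd idx (x + 6)) y

lemma encSym_some_ne (hσ : σ < 2 ^ w) (a : Fin σ) : encSym w (some a) ≠ 0 := by
  intro h
  have := congrArg BitVec.toNat h
  have ha := a.isLt
  simp only [encSym] at this
  rw [BitVec.toNat_ofNat, Nat.mod_eq_of_lt (by omega)] at this
  simp at this

lemma NodeRep.addr_lt {b x : ℕ} {A : Finset ℕ} {d : ℕ} (h : NodeRep t L idx b x A d)
    (hlen : idx.length ≤ 2 ^ w) : x < 2 ^ w := by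
  cases h with
  | leaf _ _ h =>
    have := h.length_le
    simp only [List.length_cons, List.length_nil] at this
    omega
  | node _ _ _ _ h =>
    have := h.length_le
    simp only [List.length_cons, List.length_nil] at this
    omega

/-- Symbols between `d` and the stored depth `d'` are skipped unread. This keeps the invariant,
since the candidates agree there. The number `m` of symbols not yet passed decreases, which bounds
the number of rounds. -/
lemma Located.next {m x : ℕ} (h : Located t L q idx m x) (env : QueryEnv t q idx pat j₀ tb)
    (hq : q.head? ≠ some none) (hx : (rd idx x).toNat < q.length) :
    x + 7 ≤ 2 ^ w ∧ ∃ m' < m, ∃ x',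
      nextAddr idx x (encSym w q[(rd idx x).toNat]) = BitVec.ofNat w x' ∧ x' < 2 ^ w ∧
      Located t L q idx m' x' := by
  rcases h with ⟨rfl, _⟩ | ⟨b, A, d, hrep, hb, hm, hA, hmA, hd⟩
  -- The dead record and the leaves store the depth `2 ^ w - 1`, which no pattern length exceeds, so
  -- the search has already ended at them.
  · have := env.rd_dead
    have := env.lt
    omega
  have hlen := env.length_le
  cases hrep with
  | leaf h1 h2 h3 =>
    rw [h3.rd_zero, BitVec.toNat_ofNat, Nat.mod_eq_of_lt (Nat.sub_lt (by positivity) one_pos)] at hx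
    have := env.lt
    omega
  | @node _ _ _ _ d' lo ℓ star a sh base child h1 h2 h3 h4 h5 h6 h7 h8 =>
    have r3 := h5.rd_eq (i := 3) (by simp)
    have r4 := h5.rd_eq (i := 4) (by simp)
    have r5 := h5.rd_eq (i := 5) (by simp)
    have r6 := h5.rd_eq (i := 6) (by simp)
    have h11 := h5.length_le
    simp only [List.length_cons, List.length_nil, List.getElem_cons_succ,
      List.getElem_cons_zero] at r3 r4 r5 r6 h11
    have h12 := env.text_lt
    have hd' : (rd idx x).toNat = d' := by
      rw [h5.rd_zero, BitVec.toNat_ofNat, Nat.mod_eq_of_lt (by omega)]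
    simp only [hd'] at hx ⊢
    refine ⟨by omega, q.length - (d' + 1), by omega, ?_⟩
    have hwild : numWild (q.drop d') ≤ b := (numWild_drop_le q h1).trans hb
    have hdrop : q.drop d' = q[d'] :: q.drop (d' + 1) := List.drop_eq_getElem_cons hx
    have hstep : ∀ A' ⊆ A, (∀ s ∈ A', MatchAt t q s d') →
        ∀ s ∈ A', ∀ s' ∈ A', ∀ i < d' + 1, MatchAt t q s i → MatchAt t q s' i := by
      intro A' hA' hA'' s hs s' hs' i hi hmi
      rcases lt_or_ge i d with h | h
      · exact hd s (hA' hs) s' (hA' hs') i h hmi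
      · rcases Nat.lt_succ_iff_lt_or_eq.mp hi with h9 | rfl
        · obtain ⟨c, h13, h14⟩ := hmi
          exact ⟨c, by rw [← h13]; exact h3 s' (hA' hs') s (hA' hs) i h h9, h14⟩
        · exact hA'' s' hs'
    have hqd : q[d']? = some q[d'] := List.getElem?_eq_getElem hx
    rcases hqc : q[d'] with _ | c
    · rw [hqc] at hdrop hqd
      -- Since `q` does not begin with a wildcard, the missing wildcard subtree at depth `0` is
      -- never needed.
      have hd0 : 0 < d' := by
        rcases Nat.eq_zero_or_pos d' with rfl | h
        · rw [List.head?_eq_getElem?] at hq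
          exact absurd hqd hq
        · exact h
      have hw1 : numWild (q.drop (d' + 1)) + 1 ≤ b := by
        have : numWild (q.drop d') = numWild (q.drop (d' + 1)) + 1 := by
          rw [hdrop]; simp [numWild]
        omega
      have hstar := h8 (by omega) hd0
      refine ⟨star, by simp [nextAddr, encSym, r3], hstar.addr_lt hlen, Or.inr
        ⟨b - 1, _, _, hstar, by omega, by omega,
        fun s hs => hA s (Finset.filter_subset _ _ hs), fun s hs hmat => ?_, ?_⟩⟩
      · obtain ⟨c, hc, _⟩ := hmat d' hx
        exact Finset.mem_filter.mpr ⟨hmA s hs hmat, (List.getElem?_eq_some_iff.mp hc).1⟩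
      · refine hstep _ (Finset.filter_subset _ _) fun s hs => ?_
        have := (Finset.mem_filter.mp hs).2
        exact ⟨t[s + d'], List.getElem?_eq_getElem this, Or.inl hqd⟩
    · rw [hqc] at hqd
      have hlook := h6 [] c
      rw [List.append_nil] at hlook
      have hnext : nextAddr idx x (encSym w (some c)) =
          if (childSet t A d' c).Nonempty then BitVec.ofNat w (child c) else 0 := by
        rw [nextAddr, if_neg (encSym_some_ne env.sigma_lt c), r4, r5, r6]
        exact hlook
      rw [hnext]
      have hchild : ∀ s < t.length, Matches t q s → s ∈ childSet t A d' c := by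
        intro s hs hmat
        obtain ⟨c', hc', h13⟩ := hmat d' hx
        rw [hqd] at h13
        have : c = c' := by simpa using h13
        exact Finset.mem_filter.mpr ⟨hmA s hs hmat, by rw [hc', this]⟩
      by_cases hne : (childSet t A d' c).Nonempty
      · rw [if_pos hne]
        refine ⟨child c, rfl, (h7 c hne).addr_lt hlen, Or.inr ⟨b, _, _, h7 c hne,
          (numWild_drop_le q (by omega)).trans hb, by omega,
          fun s hs => hA s (Finset.filter_subset _ _ hs), hchild, ?_⟩⟩
        refine hstep _ (Finset.filter_subset _ _) fun s hs => ?_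
        exact ⟨c, (Finset.mem_filter.mp hs).2, Or.inr hqd⟩
      · rw [if_neg hne]
        exact ⟨0, rfl, by positivity, Or.inl ⟨rfl, fun s hs hmat => hne ⟨s, hchild s hs hmat⟩⟩⟩

end Steps

/-! ### The query program for the wildcard tree -/

/-- Running the programs one after the other. -/
def chain : List Program → Program → Program
  | [], Q => Q
  | P :: l, Q => .seq P (chain l Q)

section Straight

variable {w : ℕ} {idx pat : List (BitVec w)} {s : State w} {Q : State w → Prop} {T : ℕ}
  {l : List Program} {P : Program}

@[simp] lemma setReg_reg (s : State w) (r r' : ℕ) (x : BitVec w) :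
    (s.setReg r x).reg r' = if r' = r then x else s.reg r' := by
  simp [State.setReg, Function.update_apply]

@[simp] lemma setReg_out (s : State w) (r : ℕ) (x : BitVec w) : (s.setReg r x).out = s.out := rfl

lemma chain_nil (h : Runs idx pat P s T Q) : Runs idx pat (chain [] P) s T Q := h

lemma chain_const {r v : ℕ} (h : Runs idx pat (chain l P) (s.setReg r (BitVec.ofNat w v)) T Q) :
    Runs idx pat (chain (.const r v :: l) P) s (T + 1) Q :=
  (Runs.seq (Runs.const h)).mono (by omega) fun _ => id

lemma chain_op {o : BinOp} {r a b : ℕ}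
    (h : Runs idx pat (chain l P) (s.setReg r (o.eval (s.reg a) (s.reg b))) T Q) :
    Runs idx pat (chain (.op o r a b :: l) P) s (T + 1) Q :=
  (Runs.seq (Runs.op h)).mono (by omega) fun _ => id

lemma chain_readIndex {r a : ℕ}
    (h : Runs idx pat (chain l P) (s.setReg r (cell idx (s.reg a))) T Q) :
    Runs idx pat (chain (.readIndex r a :: l) P) s (T + 1) Q :=
  (Runs.seq (Runs.readIndex h)).mono (by omega) fun _ => id

lemma chain_readPattern {r a : ℕ}
    (h : Runs idx pat (chain l P) (s.setReg r (cell pat (s.reg a))) T Q) :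
    Runs idx pat (chain (.readPattern r a :: l) P) s (T + 1) Q :=
  (Runs.seq (Runs.readPattern h)).mono (by omega) fun _ => id

end Straight

/-- The constants in the registers `1` to `4`. -/
structure Consts {w : ℕ} (s : State w) : Prop where
  zero : s.reg 1 = BitVec.ofNat w 0
  one : s.reg 2 = BitVec.ofNat w 1
  two : s.reg 3 = BitVec.ofNat w 2
  three : s.reg 4 = BitVec.ofNat w 3

/-- The state `s'` has the output of `s`, and the same registers below `r`. -/
structure Frame {w : ℕ} (r : ℕ) (s s' : State w) : Prop where
  out : s'.out = s.out
  reg : ∀ i < r, s'.reg i = s.reg i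

lemma Frame.consts {w r : ℕ} {s s' : State w} (h : Frame r s s') (hs : Consts s) (hr : 5 ≤ r) :
    Consts s' :=
  ⟨by rw [h.reg _ (by omega), hs.zero], by rw [h.reg _ (by omega), hs.one],
    by rw [h.reg _ (by omega), hs.two], by rw [h.reg _ (by omega), hs.three]⟩

lemma Frame.trans {w r : ℕ} {s s' s'' : State w} (h : Frame r s s') (h' : Frame r s' s'') :
    Frame r s s'' :=
  ⟨h'.out.trans h.out, fun i hi => (h'.reg i hi).trans (h.reg i hi)⟩

lemma Frame.refl {w r : ℕ} (s : State w) : Frame r s s := ⟨rfl, fun _ _ => rfl⟩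

lemma Frame.setReg {w r : ℕ} {s s' : State w} (h : Frame r s s') {i : ℕ} (hi : r ≤ i)
    (x : BitVec w) : Frame r s (s'.setReg i x) :=
  ⟨h.out, fun j hj => by rw [setReg_reg, if_neg (by omega), h.reg j hj]⟩

/-- Register `10` counts the wildcards at the beginning of the pattern. -/
def stripProgram : Program :=
  chain [.readPattern 11 10, .op .eq 11 11 1]
    (.loop 11 (chain [.op .add 10 10 2, .readPattern 11 10] (.op .eq 11 11 1)))

lemma ofNat_ne_zero {w n : ℕ} (h0 : 0 < n) (hn : n < 2 ^ w) : BitVec.ofNat w n ≠ 0 := by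
  intro h
  have := congrArg BitVec.toNat h
  rw [BitVec.toNat_ofNat, Nat.mod_eq_of_lt hn] at this
  simp at this; omega

lemma runs_strip {w : ℕ} {idx pat : List (BitVec w)} {s : State w} {j₀ : ℕ} (hs : Consts s)
    (hw : 0 < w) (h10 : s.reg 10 = 0) (hwild : ∀ i < j₀, cell pat (BitVec.ofNat w i) = 0)
    (hchar : cell pat (BitVec.ofNat w j₀) ≠ 0) :
    Runs idx pat stripProgram s (4 * j₀ + 3)
      fun s' => Frame 10 s s' ∧ s'.reg 10 = BitVec.ofNat w j₀ := by
  have h1 : BitVec.ofNat w 1 ≠ 0 := ofNat_ne_zero one_pos (Nat.one_lt_two_pow (by omega))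
  refine chain_readPattern <| chain_op <| chain_nil ?_
  refine (Runs.loop (T := 3) (fun m s' => Frame 10 s s' ∧ ∃ i, i + m = j₀ ∧
    s'.reg 10 = BitVec.ofNat w i ∧
    s'.reg 11 = if cell pat (BitVec.ofNat w i) = 0 then BitVec.ofNat w 1 else 0) ?_ j₀ ?_).mono
    (by omega) ?_
  · rintro m s' ⟨hf, i, him, h10', h11⟩ hne
    have hc := hf.consts hs (by omega)
    have hi : cell pat (BitVec.ofNat w i) = 0 := by
      by_contra h; rw [if_neg h] at h11; exact hne h11
    have hm : m ≠ 0 := by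
      rintro rfl
      rw [← him] at hchar; exact hchar hi
    refine chain_op <| chain_readPattern <| chain_nil <| Runs.op ?_
    refine ⟨m - 1, by omega, ((hf.setReg (by omega) _).setReg (by omega) _).setReg (by omega) _,
      i + 1, by omega, ?_, ?_⟩
    · simp [BinOp.eval, h10', hc.one, BitVec.ofNat_add]
    · simp [BinOp.eval, h10', hc.one, hc.zero, BitVec.ofNat_add]
  · refine ⟨((Frame.refl _).setReg (by omega) _).setReg (by omega) _, 0, by omega, ?_, ?_⟩
    · simp [h10]
    · simp [BinOp.eval, h10, hs.zero]
  · rintro s' ⟨h0, m, hf, i, him, h10', h11⟩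
    refine ⟨hf, ?_⟩
    rw [h0] at h11
    have hi : cell pat (BitVec.ofNat w i) ≠ 0 := by
      intro h; rw [if_pos h] at h11; exact h1 h11.symm
    have : m = 0 := by
      by_contra hm
      exact hi (hwild i (by omega))
    rw [h10', ← him, this, add_zero]

/-- Register `13` is set to the value of the key in register `16` in the dictionary of the node
whose record has its address in register `13`. -/
def lookupProgram : Program :=
  chain [.op .add 17 13 4, .op .add 17 17 2, .readIndex 18 17, .op .add 17 17 2, .readIndex 19 17,
    .op .add 17 17 2, .readIndex 20 17, .op .mul 21 18 16, .op .shr 21 21 19, .op .mul 21 4 21,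
    .op .add 21 20 21, .readIndex 18 21, .op .add 22 21 2, .readIndex 19 22, .op .add 22 21 3,
    .readIndex 20 22, .op .mul 21 18 16, .op .shr 21 21 19, .op .mul 21 3 21, .op .add 21 20 21,
    .readIndex 22 21, .op .add 21 21 2, .readIndex 23 21, .op .eq 22 22 16] (.op .mul 13 22 23)

lemma runs_lookup {w : ℕ} {idx pat : List (BitVec w)} {s : State w} {x : ℕ} (hs : Consts s)
    (hx : x + 7 ≤ 2 ^ w) (h13 : s.reg 13 = BitVec.ofNat w x) :
    Runs idx pat lookupProgram s 25 fun s' => Frame 13 s s' ∧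
      s'.reg 13 = lookup idx (rd idx (x + 4)) (rd idx (x + 5)) (rd idx (x + 6)) (s.reg 16) := by
  rw [← cell_ofNat idx (z := x + 4) (by omega), ← cell_ofNat idx (z := x + 5) (by omega),
    ← cell_ofNat idx (z := x + 6) (by omega)]
  have e4 : BitVec.ofNat w (x + 4) = s.reg 13 + s.reg 4 + s.reg 2 := by
    rw [h13, hs.three, hs.one, ← BitVec.ofNat_add, ← BitVec.ofNat_add]
  have e5 : BitVec.ofNat w (x + 5) = s.reg 13 + s.reg 4 + s.reg 2 + s.reg 2 := by
    rw [h13, hs.three, hs.one, ← BitVec.ofNat_add, ← BitVec.ofNat_add, ← BitVec.ofNat_add]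
  have e6 : BitVec.ofNat w (x + 6) = s.reg 13 + s.reg 4 + s.reg 2 + s.reg 2 + s.reg 2 := by
    rw [h13, hs.three, hs.one, ← BitVec.ofNat_add, ← BitVec.ofNat_add, ← BitVec.ofNat_add,
      ← BitVec.ofNat_add]
  rw [e4, e5, e6]
  unfold lookup bucketLookup
  rw [← hs.one, ← hs.two, ← hs.three]
  refine chain_op <| chain_op <| chain_readIndex <| chain_op <| chain_readIndex <| chain_op <|
    chain_readIndex <| chain_op <| chain_op <| chain_op <| chain_op <| chain_readIndex <|
    chain_op <| chain_readIndex <| chain_op <| chain_readIndex <| chain_op <| chain_op <|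
    chain_op <| chain_op <| chain_readIndex <| chain_op <| chain_readIndex <| chain_op <|
    chain_nil <| Runs.op ⟨⟨rfl, fun i hi => ?_⟩, ?_⟩
  · have h : ∀ j, 13 ≤ j → i ≠ j := fun j hj => by omega
    simp [h]
  · simp only [setReg_reg, BinOp.eval, Nat.reduceEqDiff, if_true, if_false]
    -- Multiplying by the result of the comparison replaces a branch: the value is kept if the keys
    -- agree and becomes `0` otherwise.
    split_ifs <;> simp

/-- One step down in the wildcard tree. -/
def stepProgram : Program :=
  chain [.op .add 16 10 14, .readPattern 16 16,
    .branch 16 lookupProgram (chain [.op .add 17 13 4] (.readIndex 13 17)),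
    .readIndex 14 13] (.op .lt 15 14 12)

/-- The situation during the search in the wildcard tree. -/
structure Walking {w σ : ℕ} (t : Text σ) (L : ℕ) (q : Pattern σ) (idx : List (BitVec w)) (j₀ : ℕ)
    (s₀ : State w) (m : ℕ) (s : State w) : Prop where
  frame : Frame 13 s₀ s
  located : ∃ x, x < 2 ^ w ∧ s.reg 13 = BitVec.ofNat w x ∧ s.reg 14 = rd idx x ∧
    s.reg 15 = (if (rd idx x).toNat < q.length then BitVec.ofNat w 1 else BitVec.ofNat w 0) ∧
    Located t L q idx m x

lemma runs_walk {w σ : ℕ} {t : Text σ} {L : ℕ} {q : Pattern σ} {idx pat : List (BitVec w)}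
    {j₀ tb : ℕ} (env : QueryEnv t q idx pat j₀ tb) (hw : 0 < w) (hL : q.length ≤ L)
    (hq : q.head? ≠ some none)
    {s₀ s : State w} (hs : Consts s₀) (h10 : s₀.reg 10 = BitVec.ofNat w j₀)
    (h12 : s₀.reg 12 = BitVec.ofNat w q.length) {m : ℕ} (hm : Walking t L q idx j₀ s₀ m s) :
    Runs idx pat (.loop 15 stepProgram) s (31 * m + 1)
      fun s' => Frame 13 s₀ s' ∧ ∃ x, s'.reg 13 = BitVec.ofNat w x ∧ Found t q idx x := by
  have h1 : BitVec.ofNat w 1 ≠ 0 := ofNat_ne_zero one_pos (Nat.one_lt_two_pow (by omega))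
  have hqlt : q.length < 2 ^ w := by have := env.lt; omega
  refine (Runs.loop (T := 30) (Walking t L q idx j₀ s₀) ?_ m hm).mono le_rfl ?_
  · rintro m s ⟨hf, x, hxw, h13, h14, h15, hloc⟩ hne
    have hc := hf.consts hs (by omega)
    have hlt : (rd idx x).toNat < q.length := by
      by_contra h; rw [if_neg h] at h15; exact hne h15
    obtain ⟨hx7, m', hm', x', hnext, hx', hloc'⟩ := hloc.next env hq hlt
    have hsym : cell pat (s.reg 10 + s.reg 14) = encSym w q[(rd idx x).toNat] := by
      rw [hf.reg 10 (by omega), h10, h14, ← env.pattern _ hlt, BitVec.ofNat_add,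
        BitVec.ofNat_toNat, BitVec.setWidth_eq]
    refine chain_op <| chain_readPattern <| Runs.seq (T := 26) (T' := 2) ?_
    set s₁ := (s.setReg 16 (BinOp.add.eval (s.reg 10) (s.reg 14))).setReg 16
      (cell pat ((s.setReg 16 (BinOp.add.eval (s.reg 10) (s.reg 14))).reg 16)) with hs₁
    have hf₁ : Frame 13 s₀ s₁ := (hf.setReg (by omega) _).setReg (by omega) _
    have hc₁ := hf₁.consts hs (by omega)
    have h16 : s₁.reg 16 = encSym w q[(rd idx x).toNat] := by
      simp [hs₁, BinOp.eval, hsym]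
    have h13' : s₁.reg 13 = BitVec.ofNat w x := by simp [hs₁, h13]
    have hmain : Runs idx pat (.branch 16 lookupProgram
        (chain [.op .add 17 13 4] (.readIndex 13 17))) s₁ 26
        fun s' => Frame 13 s₁ s' ∧ s'.reg 13 = BitVec.ofNat w x' := by
      rw [← hnext, nextAddr, ← h16]
      refine Runs.branch (fun h => ?_) (fun h => ?_)
      · rw [if_neg h]; exact runs_lookup hc₁ hx7 h13'
      · rw [if_pos h]
        refine Runs.mono (T := 2) (chain_op <| chain_nil <| Runs.readIndex ⟨?_, ?_⟩) (by omega)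
          fun _ => id
        · exact ((Frame.refl _).setReg (by omega) _).setReg (by omega) _
        · simp only [setReg_reg, if_true, BinOp.eval]
          rw [h13', hc₁.three, ← BitVec.ofNat_add, cell_ofNat _ (by omega)]
    refine hmain.mono le_rfl ?_
    rintro s₂ ⟨hf₂, h13₂⟩
    have hf₃ := hf₁.trans hf₂
    refine chain_readIndex <| chain_nil <| Runs.op ⟨m', hm', (hf₃.setReg (by omega) _).setReg
      (by omega) _, x', hx', ?_, ?_, ?_, hloc'⟩
    · simp [h13₂]
    · simp [h13₂, cell_ofNat _ hx']
    · simp only [setReg_reg, BinOp.eval, Nat.reduceEqDiff, if_true, if_false, h13₂,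
        cell_ofNat _ hx', hf₃.reg 12 (by omega), h12, BitVec.toNat_ofNat, Nat.mod_eq_of_lt hqlt]
      rfl
  · rintro s ⟨h0, m, hf, x, hxw, h13, h14, h15, hloc⟩
    refine ⟨hf, x, h13, hloc.found env hL ?_⟩
    by_contra hlt
    rw [if_pos (by omega), h0] at h15
    exact h1 h15.symm

/-! ### Comparison with the text and report of the positions -/

/-- One step of the comparison of the pattern with the text. -/
def checkStep : Program :=
  chain [.op .add 24 20 21, .readIndex 24 24, .op .add 25 10 21, .readPattern 25 25,
    .op .eq 26 25 1, .op .eq 27 25 24, .op .or 26 26 27, .op .lt 27 1 24, .op .and 22 26 27,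
    .op .add 21 21 2, .op .lt 23 21 12] (.op .and 23 23 22)

/-- The test for the symbol at position `i` of the pattern, against the text that is stored from
address `R` on. -/
def Check {w : ℕ} (idx pat : List (BitVec w)) (R : BitVec w) (j₀ i : ℕ) : Prop :=
  (cell pat (BitVec.ofNat w (j₀ + i)) = 0 ∨
    cell pat (BitVec.ofNat w (j₀ + i)) = cell idx (R + BitVec.ofNat w i)) ∧
  0 < (cell idx (R + BitVec.ofNat w i)).toNat

-- Register `22` remembers whether all tests so far succeeded. The first failure also clears the
-- loop register `23`, so the invariant distinguishes a run without failure from a run that has just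
-- stopped.
open Classical in
lemma runs_check {w : ℕ} {idx pat : List (BitVec w)} {s₀ : State w} {R : BitVec w} {j₀ m : ℕ}
    (hs : Consts s₀) (hw : 0 < w) (hm : m < 2 ^ w) (h10 : s₀.reg 10 = BitVec.ofNat w j₀)
    (h12 : s₀.reg 12 = BitVec.ofNat w m) (h20 : s₀.reg 20 = R) (h21 : s₀.reg 21 = 0)
    (h22 : s₀.reg 22 = BitVec.ofNat w 1)
    (h23 : s₀.reg 23 = if 0 < m then BitVec.ofNat w 1 else 0) :
    Runs idx pat (.loop 23 checkStep) s₀ (13 * m + 1) fun s => Frame 21 s₀ s ∧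
      s.reg 22 = if ∀ i < m, Check idx pat R j₀ i then BitVec.ofNat w 1 else 0 := by
  have h1 : BitVec.ofNat w 1 ≠ 0 := ofNat_ne_zero one_pos (Nat.one_lt_two_pow (by omega))
  refine (Runs.loop (T := 12) (fun m' s => Frame 21 s₀ s ∧ ∃ i, i + m' = m ∧
    s.reg 21 = BitVec.ofNat w i ∧
    ((s.reg 22 = BitVec.ofNat w 1 ∧ (∀ i' < i, Check idx pat R j₀ i') ∧
        s.reg 23 = if i < m then BitVec.ofNat w 1 else 0) ∨
      (s.reg 22 = 0 ∧ (¬ ∀ i' < m, Check idx pat R j₀ i') ∧ s.reg 23 = 0))) ?_ m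
    ⟨Frame.refl _, 0, by omega, h21, Or.inl ⟨h22, by simp, h23⟩⟩).mono le_rfl ?_
  · rintro m' s ⟨hf, i, him, h21, h | h⟩ hne
    swap
    · exact absurd h.2.2 hne
    obtain ⟨h22, hchk, h23⟩ := h
    have hlt : i < m := by
      by_contra h; rw [if_neg h] at h23; exact hne h23
    have hc := hf.consts hs (by omega)
    refine chain_op <| chain_readIndex <| chain_op <| chain_readPattern <| chain_op <|
      chain_op <| chain_op <| chain_op <| chain_op <| chain_op <| chain_op <| chain_nil <|
      Runs.op ⟨m' - 1, by omega, ⟨hf.out, fun j hj => ?_⟩, i + 1, by omega, ?_, ?_⟩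
    · have h : ∀ j', 21 ≤ j' → j ≠ j' := fun j' hj => by omega
      simp [h, hf.reg j hj]
    · simp [BinOp.eval, h21, hc.one, BitVec.ofNat_add]
    · simp only [setReg_reg, BinOp.eval, Nat.reduceEqDiff, if_true, if_false, h21, hc.one,
        hc.zero, hf.reg 20 (by omega), hf.reg 10 (by omega), hf.reg 12 (by omega), h20, h10, h12,
        ← BitVec.ofNat_add, BitVec.toNat_ofNat, Nat.mod_eq_of_lt hm, Nat.zero_mod,
        Nat.mod_eq_of_lt (show i + 1 < 2 ^ w by omega)]
      by_cases hcheck : Check idx pat R j₀ i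
      · left
        have hv : ((if cell pat (BitVec.ofNat w (j₀ + i)) = BitVec.ofNat w 0 then
              BitVec.ofNat w 1 else 0) |||
            (if cell pat (BitVec.ofNat w (j₀ + i)) = cell idx (R + BitVec.ofNat w i) then
              BitVec.ofNat w 1 else 0)) &&&
            (if 0 < (cell idx (R + BitVec.ofNat w i)).toNat then BitVec.ofNat w 1 else 0)
            = BitVec.ofNat w 1 := by
          rw [if_pos hcheck.2]
          have h3 := hcheck.1
          split_ifs with h4 h5 h5 <;> simp_all
        rw [hv]
        refine ⟨rfl, fun i' hi' => ?_, ?_⟩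
        · rcases Nat.lt_succ_iff_lt_or_eq.mp hi' with h | rfl
          · exact hchk i' h
          · exact hcheck
        · split_ifs <;> simp
      · right
        have hv : ((if cell pat (BitVec.ofNat w (j₀ + i)) = BitVec.ofNat w 0 then
              BitVec.ofNat w 1 else 0) |||
            (if cell pat (BitVec.ofNat w (j₀ + i)) = cell idx (R + BitVec.ofNat w i) then
              BitVec.ofNat w 1 else 0)) &&&
            (if 0 < (cell idx (R + BitVec.ofNat w i)).toNat then BitVec.ofNat w 1 else 0)
            = 0 := by
          by_cases h6 : 0 < (cell idx (R + BitVec.ofNat w i)).toNat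
          · rw [if_neg (c := cell pat (BitVec.ofNat w (j₀ + i)) = BitVec.ofNat w 0)
              (fun h4 => hcheck ⟨Or.inl h4, h6⟩), if_neg (fun h4 => hcheck ⟨Or.inr h4, h6⟩)]
            simp
          · rw [if_neg h6]; simp
        rw [hv]
        exact ⟨rfl, fun h => hcheck (h i hlt), by simp⟩
  · rintro s ⟨h0, m', hf, i, him, h21, h | h⟩
    · refine ⟨hf, ?_⟩
      obtain ⟨h22, hchk, h23⟩ := h
      have : m ≤ i := by
        by_contra h; rw [if_pos (by omega), h0] at h23; exact h1 h23.symm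
      rw [if_pos fun i' hi' => hchk i' (by omega), h22]
    · exact ⟨hf, by rw [if_neg h.2.1, h.1]⟩

/-- The word `0` stored behind the text fails every test, even opposite a wildcard. Hence successful
tests up to some position show that the text reaches that far, and the cells behind the marker never
matter. -/
lemma forall_check_iff {w σ : ℕ} {t : Text σ} {q : Pattern σ} {idx pat : List (BitVec w)}
    {j₀ tb r : ℕ} (env : QueryEnv t q idx pat j₀ tb) (hr : r ≤ t.length) :
    (∀ i < q.length, Check idx pat (BitVec.ofNat w r + BitVec.ofNat w tb) j₀ i)
      ↔ Matches t q r := by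
  have hlen := env.text.length_le
  have hlen' := env.length_le
  simp only [List.length_append, List.length_map, List.length_cons, List.length_nil] at hlen
  have hcell : ∀ i, r + i ≤ t.length →
      cell idx (BitVec.ofNat w r + BitVec.ofNat w tb + BitVec.ofNat w i)
        = (t[r + i]?).elim 0 (fun c => encSym w (some c)) := by
    intro i hi
    rw [← BitVec.ofNat_add, ← BitVec.ofNat_add, cell_ofNat _ (by omega),
      show r + tb + i = tb + (r + i) by omega, env.text.rd_eq (by simp; omega)]
    rcases Nat.lt_or_ge (r + i) t.length with h | h
    · rw [List.getElem_append_left (by simpa using h), List.getElem?_eq_getElem h]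
      simp [encSym]
    · rw [List.getElem_append_right (by simpa using h), List.getElem?_eq_none h]
      simp
  have hpos : ∀ c : Fin σ, 0 < (encSym w (some c)).toNat := by
    intro c
    have h1 := encSym_some_ne env.sigma_lt c
    rcases Nat.eq_zero_or_pos (encSym w (some c)).toNat with h | h
    · exact absurd (BitVec.eq_of_toNat_eq (by simpa using h)) h1
    · exact h
  have hinj : ∀ c c' : Fin σ, encSym w (some c) = encSym w (some c') → c = c' := by
    intro c c' h
    have h1 := congrArg BitVec.toNat h
    have h2 := c.isLt
    have h3 := c'.isLt
    have h4 := env.sigma_lt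
    simp only [encSym] at h1
    rw [BitVec.toNat_ofNat, BitVec.toNat_ofNat, Nat.mod_eq_of_lt (by omega),
      Nat.mod_eq_of_lt (by omega)] at h1
    exact Fin.ext (by omega)
  have hiff : ∀ i, i < q.length → r + i ≤ t.length →
      (Check idx pat (BitVec.ofNat w r + BitVec.ofNat w tb) j₀ i ↔ MatchAt t q r i) := by
    intro i hi hri
    unfold Check MatchAt
    rw [hcell i hri, env.pattern i hi, List.getElem?_eq_getElem hi]
    rcases t[r + i]? with _ | c
    · simp
    · rcases q[i] with _ | a
      · simp [encSym]
        simpa [encSym] using hpos c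
      · simp only [Option.elim_some, hpos c, and_true, encSym_some_ne env.sigma_lt a, false_or,
          Option.some.injEq, exists_eq_left', reduceCtorEq]
        exact ⟨fun h => hinj _ _ h, fun h => by rw [h]⟩
  constructor
  · intro h
    have key : ∀ i ≤ q.length, r + i ≤ t.length := by
      intro i
      induction i with
      | zero => intro _; exact hr
      | succ i ih =>
        intro hi
        obtain ⟨c, hc, _⟩ := (hiff i hi (ih (by omega))).mp (h i hi)
        have := (List.getElem?_eq_some_iff.mp hc).1
        omega
    exact fun i hi => (hiff i hi (key i hi.le)).mp (h i hi)
  · intro h i hi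
    obtain ⟨c, hc, _⟩ := h i hi
    have := (List.getElem?_eq_some_iff.mp hc).1
    exact (hiff i hi (by omega)).mpr (h i hi)

/-- One step of the report of the positions. -/
def reportStep : Program :=
  chain [.op .add 24 18 21, .readIndex 24 24, .op .lt 25 24 10,
    .branch 25 .skip (chain [.op .sub 24 24 10, .op .add 24 24 2] (.report 24)),
    .op .add 21 21 2] (.op .lt 23 21 19)

lemma runs_report {w : ℕ} {idx pat : List (BitVec w)} {s₀ : State w} {R : BitVec w} {j₀ : ℕ}
    {ℓ : List ℕ} (hs : Consts s₀) (hw : 0 < w) (hℓ : ℓ.length < 2 ^ w) (hj₀ : j₀ < 2 ^ w)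
    (hℓ' : ∀ s ∈ ℓ, s + 1 < 2 ^ w) (h10 : s₀.reg 10 = BitVec.ofNat w j₀)
    (h18 : s₀.reg 18 = R) (h19 : s₀.reg 19 = BitVec.ofNat w ℓ.length) (h21 : s₀.reg 21 = 0)
    (h23 : s₀.reg 23 = if 0 < ℓ.length then BitVec.ofNat w 1 else 0)
    (hR : ∀ i (h : i < ℓ.length), cell idx (R + BitVec.ofNat w i) = BitVec.ofNat w ℓ[i])
    (hout : s₀.out = []) :
    Runs idx pat (.loop 23 reportStep) s₀ (10 * ℓ.length + 1) fun s =>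
      s.out.map BitVec.toNat = (ℓ.filter (j₀ ≤ ·)).map (fun x => x - j₀ + 1) := by
  have h1 : BitVec.ofNat w 1 ≠ 0 := ofNat_ne_zero one_pos (Nat.one_lt_two_pow (by omega))
  refine (Runs.loop (T := 9) (fun m s => (∀ r < 20, s.reg r = s₀.reg r) ∧ ∃ i,
    i + m = ℓ.length ∧ s.reg 21 = BitVec.ofNat w i ∧
    (s.reg 23 = if i < ℓ.length then BitVec.ofNat w 1 else 0) ∧
    s.out.map BitVec.toNat = ((ℓ.take i).filter (j₀ ≤ ·)).map (fun x => x - j₀ + 1)) ?_ ℓ.length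
    ⟨fun _ _ => rfl, 0, by omega, h21, h23, by simp [hout]⟩).mono le_rfl ?_
  · rintro m s ⟨hf, i, him, h21, h23, ho⟩ hne
    have hlt : i < ℓ.length := by
      by_contra h; rw [if_neg h] at h23; exact hne h23
    have hx := hℓ' _ (List.getElem_mem hlt)
    have htoNat : (BitVec.ofNat w ℓ[i]).toNat = ℓ[i] := by
      rw [BitVec.toNat_ofNat, Nat.mod_eq_of_lt (by omega)]
    have hjNat : (BitVec.ofNat w j₀).toNat = j₀ := by
      rw [BitVec.toNat_ofNat, Nat.mod_eq_of_lt hj₀]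
    have hcell := hR i hlt
    have htake : ℓ.take (i + 1) = ℓ.take i ++ [ℓ[i]] := by simp
    refine chain_op <| chain_readIndex <| chain_op <| Runs.seq (T := 4) (T' := 2) ?_
    have hend : ∀ s' : State w, (∀ r < 20, s'.reg r = s₀.reg r) → s'.reg 21 = BitVec.ofNat w i →
        s'.out.map BitVec.toNat
          = ((ℓ.take (i + 1)).filter (j₀ ≤ ·)).map (fun x => x - j₀ + 1) →
        Runs idx pat (chain [.op .add 21 21 2] (.op .lt 23 21 19)) s' 2 fun s' => ∃ m' < m,
          (∀ r < 20, s'.reg r = s₀.reg r) ∧ ∃ i,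
          i + m' = ℓ.length ∧ s'.reg 21 = BitVec.ofNat w i ∧
          (s'.reg 23 = if i < ℓ.length then BitVec.ofNat w 1 else 0) ∧
          s'.out.map BitVec.toNat
            = ((ℓ.take i).filter (j₀ ≤ ·)).map (fun x => x - j₀ + 1) := by
      intro s' hf' h21' ho'
      refine chain_op <| chain_nil <| Runs.op ⟨m - 1, by omega, fun r hr => ?_, i + 1, by omega,
        ?_, ?_, ho'⟩
      · have h : ∀ j', 20 ≤ j' → r ≠ j' := fun j' hj => by omega
        simp [h, hf' r hr]
      · simp [BinOp.eval, h21', hf' 2, hs.one, BitVec.ofNat_add]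
      · simp only [setReg_reg, BinOp.eval, Nat.reduceEqDiff, if_true, if_false, h21',
          hf' 2 (by omega), hs.one, ← BitVec.ofNat_add, BitVec.toNat_ofNat, hf' 19 (by omega), h19,
          Nat.mod_eq_of_lt hℓ, Nat.mod_eq_of_lt (show i + 1 < 2 ^ w by omega)]
    refine Runs.branch (T := 3) (fun h => ?_) (fun h => ?_)
    · refine (Runs.skip (hend _ (fun r hr => ?_) ?_ ?_)).mono (by omega) fun _ => id
      · have h : ∀ j', 20 ≤ j' → r ≠ j' := fun j' hj => by omega
        simp [h, hf r hr]
      · simp [h21]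
      · have hlt : ℓ[i] < j₀ := by
          by_contra hcon
          apply h
          simp [BinOp.eval, hf 18, h18, h21, hcell, hf 10, h10, htoNat, hjNat, hcon]
        rw [htake, List.filter_append, setReg_out, setReg_out, setReg_out, ho]
        simp [hlt]
    · refine chain_op <| chain_op <| chain_nil <| Runs.report (hend _ (fun r hr => ?_) ?_ ?_)
      · have h : ∀ j', 20 ≤ j' → r ≠ j' := fun j' hj => by omega
        simp [h, hf r hr]
      · simp [h21]
      · have hle : j₀ ≤ ℓ[i] := by
          by_contra hcon
          apply h1
          simpa [BinOp.eval, hf 18, h18, h21, hcell, hf 10, h10, htoNat, hjNat,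
            Nat.lt_of_not_le hcon] using h
        have hval : BitVec.ofNat w ℓ[i] - BitVec.ofNat w j₀ + BitVec.ofNat w 1
            = BitVec.ofNat w (ℓ[i] - j₀ + 1) := by
          rw [BitVec.ofNat_add]
          congr 1
          rw [sub_eq_iff_eq_add, ← BitVec.ofNat_add, Nat.sub_add_cancel hle]
        rw [htake, List.filter_append, List.map_append, List.map_append, ← ho]
        simp only [setReg_out, setReg_reg, Nat.reduceEqDiff, if_true, if_false, BinOp.eval,
          hf 18 (by omega), h18, h21, hcell, hf 10 (by omega), h10, hf 2 (by omega), hs.one, hval]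
        simp [hle, Nat.mod_eq_of_lt (show ℓ[i] - j₀ + 1 < 2 ^ w by omega)]
  · rintro s ⟨h0, m, _, i, him, h21, h23, ho⟩
    have : ℓ.length ≤ i := by
      by_contra h; rw [if_pos (by omega), h0] at h23; exact h1 h23.symm
    rw [ho, List.take_of_length_le this]

/-- Leading wildcards only demand that enough text precedes a match of `q`. Since positions count
from `1` and starts from `0`, a start `x ≥ j₀` becomes the position `x - j₀ + 1`. -/
lemma isOccurrence_iff {σ : ℕ} {t : Text σ} {q : Pattern σ} (hq : q ≠ []) (j₀ l : ℕ) :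
    IsOccurrence t (List.replicate j₀ none ++ q) l ↔ 1 ≤ l ∧ Matches t q (l - 1 + j₀) := by
  have hq' : 0 < q.length := List.length_pos_iff.mpr hq
  have hidx : ∀ i, (List.replicate j₀ none ++ q)[j₀ + i]? = q[i]? := by
    intro i
    rw [List.getElem?_append_right (by simp)]
    simp
  unfold IsOccurrence
  rw [List.length_append, List.length_replicate]
  constructor
  · rintro ⟨h1, h2, h3⟩
    refine ⟨h1, fun i hi => ?_⟩
    have hlt : l - 1 + j₀ + i < t.length := by omega
    refine ⟨t[l - 1 + j₀ + i], List.getElem?_eq_getElem hlt, ?_⟩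
    rw [List.getElem?_eq_getElem hi]
    rcases hqi : q[i] with _ | a
    · exact Or.inl rfl
    · right
      have := h3 (j₀ + i) a (by rw [hidx, List.getElem?_eq_getElem hi, hqi])
      rw [← add_assoc, List.getElem?_eq_getElem hlt] at this
      rw [Option.some.inj this]
  · rintro ⟨h1, h2⟩
    refine ⟨h1, ?_, fun i a hia => ?_⟩
    · obtain ⟨c, hc, _⟩ := h2 (q.length - 1) (by omega)
      have := (List.getElem?_eq_some_iff.mp hc).1
      omega
    · rcases Nat.lt_or_ge i j₀ with h | h
      · rw [List.getElem?_append_left (by simpa using h)] at hia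
        simp [h] at hia
      · obtain ⟨e, rfl⟩ := Nat.exists_eq_add_of_le h
        rw [hidx] at hia
        obtain ⟨c, hc, h4⟩ := h2 e (List.getElem?_eq_some_iff.mp hia).1
        rw [hia] at h4
        rw [← add_assoc, hc]
        simpa [eq_comm] using h4

lemma mem_occurrences_iff {σ : ℕ} {t : Text σ} {q : Pattern σ} (hq : q ≠ []) (j₀ l : ℕ) :
    l ∈ occurrences t (List.replicate j₀ none ++ q) ↔ 1 ≤ l ∧ Matches t q (l - 1 + j₀) := by
  have hq' : 0 < q.length := List.length_pos_iff.mpr hq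
  simp only [occurrences, Finset.mem_filter, isOccurrence_iff hq, Finset.mem_Icc]
  refine ⟨fun h => h.2, fun h => ⟨⟨h.1, ?_⟩, h⟩⟩
  obtain ⟨c, hc, _⟩ := h.2 0 hq'
  have := (List.getElem?_eq_some_iff.mp hc).1
  omega

/-- The positions that are computed from the list of all starts at which `q` matches. -/
lemma occurrences_eq {σ : ℕ} {t : Text σ} {q : Pattern σ} (hq : q ≠ []) (j₀ : ℕ) {ℓ : List ℕ}
    (hnd : ℓ.Nodup) (hℓ : ∀ s, s ∈ ℓ ↔ Matches t q s) :
    (((ℓ.filter (j₀ ≤ ·)).map (fun x => x - j₀ + 1) : List ℕ) : Multiset ℕ)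
      = (occurrences t (List.replicate j₀ none ++ q)).val := by
  refine (Multiset.Nodup.ext ?_ (Finset.nodup _)).mpr fun l => ?_
  · rw [Multiset.coe_nodup]
    refine List.Nodup.map_on ?_ (hnd.filter _)
    intro x hx y hy hxy
    simp only [List.mem_filter, decide_eq_true_eq] at hx hy
    omega
  · rw [Multiset.mem_coe, Finset.mem_val, mem_occurrences_iff hq]
    simp only [List.mem_map, List.mem_filter, decide_eq_true_eq]
    constructor
    · rintro ⟨x, ⟨hx, hj⟩, rfl⟩
      refine ⟨by omega, ?_⟩
      rw [show x - j₀ + 1 - 1 + j₀ = x by omega]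
      exact (hℓ x).mp hx
    · rintro ⟨h1, h2⟩
      exact ⟨l - 1 + j₀, ⟨(hℓ _).mpr h2, by omega⟩, by omega⟩

/-- Only the starts below `j₀` are scanned without being reported, and there are at most `j₀` of
them. This charges the scan of the whole list to `occ + j`. -/
lemma length_le_occ {σ : ℕ} {t : Text σ} {q : Pattern σ} (hq : q ≠ []) (j₀ : ℕ) {ℓ : List ℕ}
    (hnd : ℓ.Nodup) (hℓ : ∀ s, s ∈ ℓ ↔ Matches t q s) :
    ℓ.length ≤ occ t (List.replicate j₀ none ++ q) + j₀ := by
  have h1 : occ t (List.replicate j₀ none ++ q) = (ℓ.filter (j₀ ≤ ·)).length := by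
    rw [occ, ← Finset.card_val, ← occurrences_eq hq j₀ hnd hℓ]
    simp
  have h2 : (ℓ.filter (fun x => !decide (j₀ ≤ x))).length ≤ j₀ := by
    rw [← List.toFinset_card_of_nodup (hnd.filter _)]
    refine (Finset.card_le_card (t := Finset.range j₀) fun x hx => ?_).trans (by simp)
    simpa using (List.mem_filter.mp (List.mem_toFinset.mp hx)).2
  have h3 := List.length_eq_length_filter_add (l := ℓ) (fun x => decide (j₀ ≤ x))
  omega

/-- Reporting the positions that are listed in the record at the address in register `13`, if the
first one of them passes the comparison with the pattern. -/
def outputProgram : Program :=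
  chain [.op .add 17 13 2, .readIndex 18 17, .op .add 17 13 3, .readIndex 19 17, .readIndex 20 18,
    .const 24 6, .readIndex 24 24, .op .add 20 20 24, .const 21 0, .const 22 1, .op .lt 23 1 12]
    (.seq (.loop 23 checkStep)
      (chain [.op .mul 19 19 22, .const 21 0, .op .lt 23 1 19] (.loop 23 reportStep)))

/-- A query in the wildcard tree. -/
def treeProgram : Program :=
  .seq stripProgram
    (chain [.op .sub 12 0 10, .const 13 7, .readIndex 13 13, .readIndex 13 13, .readIndex 14 13,
      .op .lt 15 14 12] (.seq (.loop 15 stepProgram) outputProgram))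

/-- By `Found` the first listed start decides for all of them. The count is multiplied by the
outcome of this one comparison, so that either the full list or nothing is reported. -/
lemma runs_output {w σ : ℕ} {t : Text σ} {q : Pattern σ} {idx pat : List (BitVec w)}
    {j₀ tb x : ℕ} (env : QueryEnv t q idx pat j₀ tb) (hw : 3 ≤ w) (hq : q ≠ []) {s : State w}
    (hs : Consts s) (h10 : s.reg 10 = BitVec.ofNat w j₀)
    (h12 : s.reg 12 = BitVec.ofNat w q.length) (h13 : s.reg 13 = BitVec.ofNat w x)
    (hx : Found t q idx x) (h6 : rd idx 6 = BitVec.ofNat w tb) (hout : s.out = []) :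
    Runs idx pat outputProgram s
      (10 * (occ t (List.replicate j₀ none ++ q) + j₀) + 13 * q.length + 16) fun s' =>
      ((s'.out.map BitVec.toNat : List ℕ) : Multiset ℕ)
        = (occurrences t (List.replicate j₀ none ++ q)).val := by
  classical
  obtain ⟨lo, ℓ, hx2, hlo, hcnt, hnd, hblock, hℓn, hmem, hall⟩ := hx
  have h8 : 8 ≤ 2 ^ w := (show 2 ^ 3 ≤ 2 ^ w from Nat.pow_le_pow_right (by norm_num) hw)
  have hqlt : q.length < 2 ^ w := by have := env.lt; omega
  have hn := env.text_lt
  have hidx := env.length_le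
  have hblen := hblock.length_le
  rw [List.length_map] at hblen
  have htb := env.text.length_le
  simp only [List.length_append, List.length_cons, List.length_nil] at htb
  have hR : ∀ i (h : i < ℓ.length),
      cell idx (BitVec.ofNat w lo + BitVec.ofNat w i) = BitVec.ofNat w ℓ[i] := by
    intro i hi
    rw [← BitVec.ofNat_add, cell_ofNat _ (by omega), hblock.rd_eq (by simpa using hi)]
    simp
  have a1 : BitVec.ofNat w x + BitVec.ofNat w 1 = BitVec.ofNat w (x + 1) := by
    rw [BitVec.ofNat_add]
  have a2 : BitVec.ofNat w x + BitVec.ofNat w 2 = BitVec.ofNat w (x + 2) := by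
    rw [BitVec.ofNat_add]
  refine Runs.mono (T := (13 * q.length + 1 + (10 * (occ t (List.replicate j₀ none ++ q) + j₀) + 1
    + 3)) + 11) ?_ (by omega) fun _ => id
  refine chain_op <| chain_readIndex <| chain_op <| chain_readIndex <| chain_readIndex <|
    chain_const <| chain_readIndex <| chain_op <| chain_const <| chain_const <| chain_op <|
    chain_nil <| Runs.seq ?_
  refine (runs_check (j₀ := j₀) (m := q.length) (R := cell idx (BitVec.ofNat w lo)
    + BitVec.ofNat w tb) ?_ (by omega) hqlt ?_ ?_ ?_ ?_ ?_ ?_).mono le_rfl ?_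
  · exact ⟨by simp [hs.zero], by simp [hs.one], by simp [hs.two], by simp [hs.three]⟩
  · simp [h10]
  · simp [h12]
  · simp only [setReg_reg, BinOp.eval, Nat.reduceEqDiff, if_true, if_false, h13, hs.one, a1,
      cell_ofNat idx (show x + 1 < 2 ^ w by omega), hlo,
      cell_ofNat idx (show 6 < 2 ^ w by omega), h6]
  · simp
  · simp
  · simp [BinOp.eval, hs.zero, h12, Nat.mod_eq_of_lt hqlt]
  rintro s₁ ⟨hf, h22⟩
  -- the list of the positions to be considered
  obtain ⟨ℓ', hnd', hℓ', hlen', hmatch, hR', h1922⟩ : ∃ ℓ' : List ℕ, ℓ'.Nodup ∧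
      (∀ s ∈ ℓ', s < t.length) ∧ ℓ'.length ≤ ℓ.length ∧ (∀ s, s ∈ ℓ' ↔ Matches t q s) ∧
      (∀ i (h : i < ℓ'.length),
        cell idx (BitVec.ofNat w lo + BitVec.ofNat w i) = BitVec.ofNat w ℓ'[i]) ∧
      BitVec.ofNat w ℓ.length * s₁.reg 22 = BitVec.ofNat w ℓ'.length := by
    have hmlt : ∀ s, Matches t q s → s < t.length := by
      intro s h
      obtain ⟨c, hc, _⟩ := h 0 (List.length_pos_iff.mpr hq)
      have := (List.getElem?_eq_some_iff.mp hc).1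
      omega
    -- For an empty list the word read as first start is meaningless, but the count `0` makes the
    -- outcome of the comparison irrelevant.
    rcases Nat.eq_zero_or_pos ℓ.length with h0 | hpos
    · rw [List.length_eq_zero_iff] at h0
      subst h0
      refine ⟨[], by simp, by simp, by simp, fun s => ⟨by simp, fun h => hmem s (hmlt s h) h⟩,
        by simp, by simp⟩
    · have hrep := hR 0 hpos
      rw [show BitVec.ofNat w lo + BitVec.ofNat w 0 = BitVec.ofNat w lo by simp] at hrep
      rw [hrep] at h22
      have h0 := hℓn _ (List.getElem_mem hpos)
      have hiff := forall_check_iff env h0.le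
      rw [if_congr hiff rfl rfl] at h22
      by_cases hm0 : Matches t q ℓ[0]
      · rw [if_pos hm0] at h22
        refine ⟨ℓ, hnd, hℓn, le_rfl, fun s => ⟨fun hsℓ => hall _ (List.getElem_mem hpos) s hsℓ hm0,
          fun h => hmem s (hmlt s h) h⟩, hR, by simp [h22]⟩
      · rw [if_neg hm0] at h22
        refine ⟨[], by simp, by simp, by simp, fun s => ⟨by simp, fun h => ?_⟩, by simp,
          by simp [h22]⟩
        exact absurd (hall s (hmem s (hmlt s h) h) _ (List.getElem_mem hpos) h) hm0
  have hlen2 : ℓ'.length < 2 ^ w := by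
    have h1 : ℓ'.toFinset ⊆ Finset.range t.length := fun s hs => by
      simpa using hℓ' s (List.mem_toFinset.mp hs)
    have h2 := Finset.card_le_card h1
    rw [List.toFinset_card_of_nodup hnd', Finset.card_range] at h2
    omega
  have hocc := length_le_occ hq j₀ hnd' hmatch
  have r18 : s₁.reg 18 = BitVec.ofNat w lo := by
    rw [hf.reg 18 (by omega)]
    simp only [setReg_reg, BinOp.eval, Nat.reduceEqDiff, if_true, if_false, h13, hs.one, a1,
      cell_ofNat idx (show x + 1 < 2 ^ w by omega), hlo]
  have r19 : s₁.reg 19 = BitVec.ofNat w ℓ.length := by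
    rw [hf.reg 19 (by omega)]
    simp only [setReg_reg, BinOp.eval, Nat.reduceEqDiff, if_true, if_false, h13, hs.two, a2,
      cell_ofNat idx (show x + 2 < 2 ^ w by omega), hcnt]
  have r10 : s₁.reg 10 = BitVec.ofNat w j₀ := by
    rw [hf.reg 10 (by omega)]
    simp [h10]
  have hc₁ : Consts s₁ := hf.consts
    ⟨by simp [hs.zero], by simp [hs.one], by simp [hs.two], by simp [hs.three]⟩ (by omega)
  have hout₁ : s₁.out = [] := by rw [hf.out]; simp [hout]
  refine chain_op <| chain_const <| chain_op <| chain_nil ?_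
  refine (runs_report (j₀ := j₀) (ℓ := ℓ') (R := BitVec.ofNat w lo) ?_ (by omega) hlen2
    (by have := env.lt; omega) (fun s hsℓ => by have := hℓ' s hsℓ; omega) ?_ ?_ ?_ ?_ ?_ hR'
    ?_).mono (by omega) ?_
  · exact ⟨by simp [hc₁.zero], by simp [hc₁.one], by simp [hc₁.two], by simp [hc₁.three]⟩
  · simp [r10]
  · simp [r18]
  · simp [BinOp.eval, r19, h1922]
  · simp
  · simp only [setReg_reg, BinOp.eval, Nat.reduceEqDiff, if_true, if_false, r19, h1922, hc₁.zero,
      BitVec.toNat_ofNat, Nat.zero_mod, Nat.mod_eq_of_lt hlen2]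
  · simp [hout₁]
  · intro s' ho
    rw [ho]
    exact occurrences_eq hq j₀ hnd' hmatch

lemma cell_encodePattern {w σ : ℕ} (p : Pattern σ) {i : ℕ} (hi : i < p.length)
    (hp : p.length < 2 ^ w) : cell (encodePattern w p) (BitVec.ofNat w i) = encSym w p[i] := by
  have h : encodePattern w p = p.map (encSym w) := by
    unfold encodePattern
    congr 1
  rw [cell_ofNat _ (by omega), h]
  simp [rd, List.getD_eq_getElem?_getD, hi]

lemma runs_tree {w σ : ℕ} {t : Text σ} {L : ℕ} {q : Pattern σ} {idx : List (BitVec w)}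
    {j₀ tb rp root b : ℕ} {a : Fin σ}
    (env : QueryEnv t q idx (encodePattern w (List.replicate j₀ none ++ q)) j₀ tb) (hw : 3 ≤ w)
    (hq : q.head? = some (some a)) (hL : q.length ≤ L) (hb : numWild q ≤ b)
    (h6 : rd idx 6 = BitVec.ofNat w tb) (h7 : rd idx 7 = BitVec.ofNat w rp) (hrp : rp < 2 ^ w)
    (hroot : rd idx rp = BitVec.ofNat w root)
    (hrep : NodeRep t L idx b root (Finset.range t.length) 0) {s : State w} (hs : Consts s)
    (h0 : s.reg 0 = BitVec.ofNat w (List.replicate j₀ none ++ q).length) (h10 : s.reg 10 = 0)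
    (hout : s.out = []) :
    Runs idx (encodePattern w (List.replicate j₀ none ++ q)) treeProgram s
      (10 * occ t (List.replicate j₀ none ++ q) + 14 * j₀ + 44 * q.length + 26) fun s' =>
      ((s'.out.map BitVec.toNat : List ℕ) : Multiset ℕ)
        = (occurrences t (List.replicate j₀ none ++ q)).val := by
  have hq0 : q ≠ [] := by rintro rfl; simp at hq
  have hqpos : 0 < q.length := List.length_pos_iff.mpr hq0
  have hlt := env.lt
  have h8 : 8 ≤ 2 ^ w := (show 2 ^ 3 ≤ 2 ^ w from Nat.pow_le_pow_right (by norm_num) hw)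
  have hplen : (List.replicate j₀ none ++ q).length = j₀ + q.length := by simp
  refine Runs.mono (T := (4 * j₀ + 3) + ((31 * q.length + 1 +
    (10 * (occ t (List.replicate j₀ none ++ q) + j₀) + 13 * q.length + 16)) + 6)) ?_ (by omega)
    fun _ => id
  refine Runs.seq ((runs_strip hs (by omega) h10 (fun i hi => ?_) ?_).mono le_rfl ?_)
  · rw [cell_encodePattern _ (by omega) (by omega), List.getElem_append_left (by simpa using hi)]
    simp [encSym]
  · have := env.pattern 0 hqpos
    rw [add_zero] at this
    rw [this]
    rw [List.head?_eq_getElem?, List.getElem?_eq_getElem hqpos] at hq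
    rw [Option.some.inj hq]
    exact encSym_some_ne env.sigma_lt a
  rintro s₁ ⟨hf₁, r10⟩
  have hc₁ := hf₁.consts hs (by omega)
  have r0 := hf₁.reg 0 (by omega)
  rw [h0, hplen] at r0
  have hsub : BitVec.ofNat w (j₀ + q.length) - BitVec.ofNat w j₀ = BitVec.ofNat w q.length := by
    rw [sub_eq_iff_eq_add, ← BitVec.ofNat_add, add_comm]
  have hrootlt := hrep.addr_lt env.length_le
  have hqn : q.head? ≠ some none := by rw [hq]; simp
  have hqlt : q.length < 2 ^ w := by omega
  have c7 : cell idx (BitVec.ofNat w 7) = BitVec.ofNat w rp := by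
    rw [cell_ofNat _ (by omega), h7]
  have crp : cell idx (BitVec.ofNat w rp) = BitVec.ofNat w root := by
    rw [cell_ofNat _ hrp, hroot]
  refine chain_op <| chain_const <| chain_readIndex <| chain_readIndex <| chain_readIndex <|
    chain_op <| chain_nil <| Runs.seq ?_
  set s₂ := s₁.setReg 12 (BitVec.ofNat w q.length) with hs₂
  refine (runs_walk (s₀ := s₂) (m := q.length) env (by omega) hL hqn ?_ ?_ ?_
    ⟨⟨?_, ?_⟩, root, hrootlt, ?_, ?_, ?_, ?_⟩).mono le_rfl ?_
  · exact ⟨by simp [hs₂, hc₁.zero], by simp [hs₂, hc₁.one], by simp [hs₂, hc₁.two],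
      by simp [hs₂, hc₁.three]⟩
  · simp [hs₂, r10]
  · simp [hs₂]
  · simp [hs₂]
  · intro i hi
    have h : ∀ j', 13 ≤ j' → i ≠ j' := fun j' hj => by omega
    simp [hs₂, h, BinOp.eval, r0, r10, hsub]
  · simp only [setReg_reg, Nat.reduceEqDiff, if_true, if_false, c7, crp]
  · simp only [setReg_reg, Nat.reduceEqDiff, if_true, if_false, c7, crp, cell_ofNat _ hrootlt]
  · simp only [setReg_reg, Nat.reduceEqDiff, if_true, if_false, c7, crp, cell_ofNat _ hrootlt,
      BinOp.eval, r0, r10, hsub, BitVec.toNat_ofNat, Nat.mod_eq_of_lt hqlt]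
    rfl
  · exact Or.inr ⟨b, _, 0, hrep, by simpa using hb, by simp, by simp,
      fun s hs _ => by simpa using hs, by simp⟩
  · rintro s₃ ⟨hf₃, x, r13, hx⟩
    have hc₂ : Consts s₂ := ⟨by simp [hs₂, hc₁.zero], by simp [hs₂, hc₁.one],
      by simp [hs₂, hc₁.two], by simp [hs₂, hc₁.three]⟩
    refine runs_output env hw hq0 (hf₃.consts hc₂ (by omega)) ?_ ?_ r13 hx h6 ?_
    · rw [hf₃.reg 10 (by omega)]; simp [hs₂, r10]
    · rw [hf₃.reg 12 (by omega)]; simp [hs₂]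
    · rw [hf₃.out]; simp [hs₂, hf₁.out, hout]

/-! ### The height of the suffix tree -/

section Height

variable {σ : ℕ} {t : Text σ}

lemma terminated_eq : terminated t = t.map WithTop.some ++ [⊤] := by
  unfold terminated
  congr 1
  induction t with
  | nil => rfl
  | cons a t ih => simpa using ih

lemma terminated_getElem? {i : ℕ} (hi : i ≤ t.length) :
    (terminated t)[i]? = some ((t[i]?).elim ⊤ fun a => (a : WithTop (Fin σ))) := by
  rw [terminated_eq]
  rcases Nat.lt_or_ge i t.length with h | h
  · rw [List.getElem?_append_left (by simpa using h), List.getElem?_map,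
      List.getElem?_eq_getElem h]
    rfl
  · obtain rfl : i = t.length := by omega
    rw [List.getElem?_append_right (by simp)]
    simp

lemma length_terminated : (terminated t).length = t.length + 1 := by simp [terminated]

lemma drop_mem_suffixSet {i : ℕ} (hi : i ≤ t.length) : (terminated t).drop i ∈ suffixSet t := by
  unfold suffixSet
  rw [Finset.mem_erase, List.mem_toFinset, List.mem_tails]
  refine ⟨fun h => ?_, List.drop_suffix _ _⟩
  have := congrArg List.length h
  rw [List.length_drop, length_terminated] at this
  simp at this; omega

/-- Below depth `d₀` the suffixes are compared as if they began at `s + d₀` and `s' + d₀`. A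
disagreement at depth `i` makes their common part a string with two continuations, one of which may
be the end marker. -/
lemma isTrieVertex_of_branch {d₀ s s' i : ℕ} (hs : s + d₀ ≤ t.length) (hs' : s' + d₀ ≤ t.length)
    (hi : d₀ ≤ i) (hag : ∀ e, d₀ ≤ e → e < i → t[s + e]? = t[s' + e]?)
    (hne : t[s + i]? ≠ t[s' + i]?) :
    s + i ≤ t.length ∧
      IsTrieVertex (suffixSet t) (((terminated t).drop (s + d₀)).take (i - d₀)) := by
  have hle : ∀ s s', s + d₀ ≤ t.length → (∀ e, d₀ ≤ e → e < i → t[s + e]? = t[s' + e]?) →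
      t[s + i]? ≠ t[s' + i]? → s + i ≤ t.length := by
    intro s s' hs hag hne
    by_contra! hcon
    -- If one suffix ended before depth `i`, the other would end there too, and both entries at
    -- depth `i` would be `none`.
    have h1 := hag (t.length - s) (by omega) (by omega)
    rw [show s + (t.length - s) = t.length by omega, List.getElem?_eq_none le_rfl, eq_comm,
      List.getElem?_eq_none_iff] at h1
    apply hne
    rw [List.getElem?_eq_none (by omega), List.getElem?_eq_none (by omega)]
  have h1 := hle s s' hs hag hne
  have h2 := hle s' s hs' (fun e h3 h4 => (hag e h3 h4).symm) hne.symm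
  refine ⟨h1, Or.inr (Or.inr ⟨_, drop_mem_suffixSet hs, _, drop_mem_suffixSet hs',
    (t[s + i]?).elim ⊤ fun a => (a : WithTop (Fin σ)),
    (t[s' + i]?).elim ⊤ fun a => (a : WithTop (Fin σ)), ?_, ?_, ?_⟩)⟩
  · have hinj : ∀ o o' : Option (Fin σ), (o.elim ⊤ fun a => (a : WithTop (Fin σ)))
        = (o'.elim ⊤ fun a => (a : WithTop (Fin σ))) → o = o' := by
      rintro (_ | a) (_ | b) h <;> simp_all
    exact fun h => hne (hinj _ _ h)
  · have : ((terminated t).drop (s + d₀))[i - d₀]?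
        = some ((t[s + i]?).elim ⊤ fun a => (a : WithTop (Fin σ))) := by
      rw [List.getElem?_drop, show s + d₀ + (i - d₀) = s + i by omega, terminated_getElem? h1]
    obtain ⟨h3, h4⟩ := List.getElem?_eq_some_iff.mp this
    rw [← h4, List.take_append_getElem]
    exact List.take_prefix _ _
  · have htake : ((terminated t).drop (s + d₀)).take (i - d₀)
        = ((terminated t).drop (s' + d₀)).take (i - d₀) := by
      refine List.ext_getElem? fun e => ?_
      rw [List.getElem?_take, List.getElem?_take]
      split_ifs with he
      · rw [List.getElem?_drop, List.getElem?_drop, terminated_getElem? (by omega),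
          terminated_getElem? (by omega), add_assoc, add_assoc,
          hag (d₀ + e) (by omega) (by omega)]
      · rfl
    have : ((terminated t).drop (s' + d₀))[i - d₀]?
        = some ((t[s' + i]?).elim ⊤ fun a => (a : WithTop (Fin σ))) := by
      rw [List.getElem?_drop, show s' + d₀ + (i - d₀) = s' + i by omega, terminated_getElem? h2]
    obtain ⟨h3, h4⟩ := List.getElem?_eq_some_iff.mp this
    rw [htake, ← h4, List.take_append_getElem]
    exact List.take_prefix _ _

lemma trieDepth_le_height {i : ℕ} (hi : i ≤ t.length) :
    trieDepth (suffixSet t) ((terminated t).drop i) ≤ suffixTreeHeight t :=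
  Finset.le_sup (f := trieDepth (suffixSet t)) (drop_mem_suffixSet hi)

open Classical in
lemma image_branchDepths_subset {L d₀ s : ℕ} (hs : s + d₀ ≤ t.length) :
    (branchDepths t L d₀ s).image (· - d₀) ⊆
      (Finset.range ((terminated t).drop (s + d₀)).length).filter
        (fun i => IsTrieVertex (suffixSet t) (((terminated t).drop (s + d₀)).take i)) := by
  intro e he
  obtain ⟨i, hi, rfl⟩ := Finset.mem_image.mp he
  simp only [branchDepths, Finset.mem_filter] at hi
  obtain ⟨_, h1, _, s', hs', hag, hne⟩ := hi
  obtain ⟨h2, h3⟩ := isTrieVertex_of_branch hs hs' h1 hag hne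
  rw [Finset.mem_filter, Finset.mem_range, List.length_drop, length_terminated]
  exact ⟨by omega, h3⟩

lemma card_image_branchDepths (L d₀ s : ℕ) :
    ((branchDepths t L d₀ s).image (· - d₀)).card = (branchDepths t L d₀ s).card := by
  refine Finset.card_image_of_injOn fun i hi j hj hij => ?_
  simp only [branchDepths, Finset.coe_filter, Set.mem_ofPred_eq] at hi hj
  omega

lemma branchDepths_subset (L d₀ s : ℕ) : branchDepths t L d₀ s ⊆ Finset.range L := by
  intro i hi
  simp only [branchDepths, Finset.mem_filter] at hi
  exact hi.1

lemma card_branchDepths_le {L d₀ s : ℕ} (hs : s + d₀ ≤ t.length) :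
    (branchDepths t L d₀ s).card ≤ min L (suffixTreeHeight t) := by
  refine le_min ?_ ?_
  · exact (Finset.card_le_card (branchDepths_subset _ _ _)).trans (by simp)
  · rw [← card_image_branchDepths]
    refine (Finset.card_le_card (image_branchDepths_subset hs)).trans ?_
    exact trieDepth_le_height hs

/-- Depth `0` is not counted as a branching depth, yet it lies in `range L` and the root is a vertex
of the suffix tree. Adding it to the set gains one in both bounds. -/
lemma card_branchDepths_zero_le {L s : ℕ} (hs : s ≤ t.length) :
    (branchDepths t L 0 s).card ≤ min L (suffixTreeHeight t) - 1 := by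
  classical
  rcases Nat.eq_zero_or_pos L with rfl | hL
  · simp [branchDepths]
  have h0 : 0 ∉ branchDepths t L 0 s := by simp [branchDepths]
  have h1 : (branchDepths t L 0 s).card + 1 ≤ L := by
    rw [← Finset.card_insert_of_notMem h0]
    refine (Finset.card_le_card (t := Finset.range L) ?_).trans (by simp)
    refine Finset.insert_subset (by simpa using hL) (branchDepths_subset _ _ _)
  have h2 : (branchDepths t L 0 s).card + 1 ≤ suffixTreeHeight t := by
    rw [← card_image_branchDepths, ← Finset.card_insert_of_notMem (a := 0) (by simpa using h0)]
    refine le_trans (Finset.card_le_card (Finset.insert_subset ?_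
      (image_branchDepths_subset (t := t) (L := L) (d₀ := 0) (s := s) hs)))
      (trieDepth_le_height (t := t) (i := s + 0) hs)
    rw [Finset.mem_filter, Finset.mem_range, List.length_drop, length_terminated]
    exact ⟨by omega, Or.inl (by simp)⟩
  omega

lemma one_le_suffixTreeHeight : 1 ≤ suffixTreeHeight t := by
  classical
  refine le_trans ?_ (trieDepth_le_height (t := t) (i := 0) (by omega))
  refine Finset.card_pos.mpr ⟨0, ?_⟩
  rw [Finset.mem_filter, Finset.mem_range, List.length_drop, length_terminated]
  exact ⟨by omega, Or.inl (by simp)⟩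

end Height

/-! ### The reduction -/

/-- The query program that results from `P`: patterns that are longer than the word in cell `3` of
the index are passed on to `P`, the other ones are searched in the wildcard tree. -/
def reductionProgram (P : Program) : Program :=
  chain [.const 2 1, .const 3 2, .op .add 4 2 3, .readIndex 5 4, .op .lt 6 5 0]
    (.branch 6
      (chain [.const 5 4, .readIndex 5 5, .const 6 5, .readIndex 6 6, .op .add 40 0 1]
        (relocate P))
      treeProgram)

section Reduction

variable {w σ : ℕ} {t : Text σ} {p : Pattern σ} {P : Program} {idxA idxB : List (BitVec w)}

lemma ofNat_three : BitVec.ofNat w 1 + BitVec.ofNat w 2 = BitVec.ofNat w 3 := by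
  rw [← BitVec.ofNat_add]

lemma answers_of_long {T : ℝ} (hw : 0 < w)
    (hA : ∀ a : BitVec w, cell idxA a = if a.toNat < (cell idxB (BitVec.ofNat w 5)).toNat then
      cell idxB (cell idxB (BitVec.ofNat w 4) + a) else 0)
    (hlong : (cell idxB (BitVec.ofNat w 3)).toNat < p.length) (hp : p.length < 2 ^ w)
    (h : AnswersQuery P idxA t p T) :
    AnswersQuery (reductionProgram P) idxB t p (5 * T + 11) := by
  obtain ⟨τ, s, hex, hτ, hs⟩ := h
  have h1 : BitVec.ofNat w 1 ≠ 0 := ofNat_ne_zero one_pos (Nat.one_lt_two_pow (by omega))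
  have hrun : Runs idxB (encodePattern w p) (reductionProgram P) (initState w p.length)
      (5 * τ + 5 + 1 + 5) fun s' => s'.out = s.out := by
    refine chain_const <| chain_const <| chain_op <| chain_readIndex <| chain_op <| chain_nil <|
      Runs.branch (fun _ => ?_) (fun h => ?_)
    · refine chain_const <| chain_readIndex <| chain_const <| chain_readIndex <| chain_op <|
        chain_nil <| Runs.mono (T := 5 * τ) (Q := Simulates (cell idxB (BitVec.ofNat w 4))
          (cell idxB (BitVec.ofNat w 5)) s) ?_ le_rfl fun s' h => h.out
      refine runs_relocate hw hA hex _ ⟨fun r => ?_, ?_, ?_, ?_, ?_⟩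
      · rcases Nat.eq_zero_or_pos r with rfl | hr
        · simp [BinOp.eval, initState]
        · have h : ∀ j, j < 40 → ¬ r + 40 = j := fun j hj => by omega
          simp [h, hr.ne', initState]
      · rfl
      · rfl
      · simp
      · simp
    · simp only [setReg_reg, BinOp.eval, Nat.reduceEqDiff, if_true, if_false,
        ofNat_three, initState, BitVec.toNat_ofNat, Nat.mod_eq_of_lt hp, hlong] at h
      exact absurd h h1
  obtain ⟨τ', s', hex', hτ', hs'⟩ := hrun
  refine ⟨τ', s', hex', ?_, by rw [hs', hs]⟩
  have : (τ' : ℝ) ≤ ((5 * τ + 5 + 1 + 5 : ℕ) : ℝ) := by exact_mod_cast hτ'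
  push_cast at this
  linarith

lemma exists_eq_replicate_append (hp : 0 < numChars p) :
    ∃ (j₀ : ℕ) (q : Pattern σ) (a : Fin σ), p = List.replicate j₀ none ++ q ∧
      q.head? = some (some a) := by
  induction p with
  | nil => simp [numChars] at hp
  | cons x p ih =>
    rcases x with _ | a
    · obtain ⟨j₀, q, a, rfl, h⟩ := ih (by simpa [numChars] using hp)
      exact ⟨j₀ + 1, q, a, by simp [List.replicate_succ], h⟩
    · exact ⟨0, some a :: p, a, by simp, rfl⟩

/-- The array `idx` consists of a header, the array `idxA`, the text, and a wildcard tree of depth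
`L` with `k` levels of wildcards. -/
structure IsTreeIndex (t : Text σ) (L k : ℕ) (idxA idx : List (BitVec w)) (tb rp root : ℕ) :
    Prop where
  length_le : idx.length ≤ 2 ^ w
  header : Block idx 0 [BitVec.ofNat w (2 ^ w - 1), 0, 0, BitVec.ofNat w (min L (2 ^ w - 1)),
    BitVec.ofNat w 8, BitVec.ofNat w idxA.length, BitVec.ofNat w tb, BitVec.ofNat w rp]
  index : Block idx 8 idxA
  text : Block idx tb (t.map (fun a => BitVec.ofNat w (a.val + 1)) ++ [0])
  rp_lt : rp < 2 ^ w
  rd_rp : rd idx rp = BitVec.ofNat w root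
  root : NodeRep t L idx k root (Finset.range t.length) 0

lemma answers_of_short {L k tb rp root : ℕ} (hw : 3 ≤ w) (hσ : σ < 2 ^ w)
    (ht : t.length < 2 ^ w)
    (hidx : IsTreeIndex t L k idxA idxB tb rp root) (hp0 : 0 < numChars p)
    (hk : numWild p ≤ k) (hp : p.length < 2 ^ w) (hL : p.length ≤ L) :
    AnswersQuery (reductionProgram P) idxB t p (10 * (occ t p : ℝ) + 44 * p.length + 32) := by
  obtain ⟨j₀, q, a, rfl, hq⟩ := exists_eq_replicate_append hp0
  have h8 : 8 ≤ 2 ^ w := (show 2 ^ 3 ≤ 2 ^ w from Nat.pow_le_pow_right (by norm_num) hw)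
  have hplen : (List.replicate j₀ none ++ q).length = j₀ + q.length := by simp
  have rd3 : cell idxB (BitVec.ofNat w 3) = BitVec.ofNat w (min L (2 ^ w - 1)) := by
    rw [cell_ofNat _ (by omega)]
    simpa using hidx.header.rd_eq (i := 3) (by simp)
  have rd6 := hidx.header.rd_eq (i := 6) (by simp)
  have rd7 := hidx.header.rd_eq (i := 7) (by simp)
  simp only [zero_add, List.getElem_cons_succ, List.getElem_cons_zero] at rd6 rd7
  have env : QueryEnv t q idxB (encodePattern w (List.replicate j₀ none ++ q)) j₀ tb := by
    refine ⟨hidx.length_le, by omega, hσ, ht, fun i hi => ?_, hidx.text, ?_⟩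
    · rw [cell_encodePattern _ (by omega) hp, List.getElem_append_right (by simp)]
      simp
    · obtain ⟨u, v, h1, h2⟩ := hidx.header
      exact ⟨u, _, by rw [h1]; simp; rfl, h2⟩
  have hb : numWild q ≤ k := by
    refine le_trans ?_ hk
    simp [numWild]
  have hrun : Runs idxB (encodePattern w (List.replicate j₀ none ++ q)) (reductionProgram P)
      (initState w (List.replicate j₀ none ++ q).length)
      (10 * occ t (List.replicate j₀ none ++ q) + 14 * j₀ + 44 * q.length + 26 + 1 + 5)
      fun s' => ((s'.out.map BitVec.toNat : List ℕ) : Multiset ℕ)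
        = (occurrences t (List.replicate j₀ none ++ q)).val := by
    refine chain_const <| chain_const <| chain_op <| chain_readIndex <| chain_op <| chain_nil <|
      Runs.branch (fun h => ?_) (fun _ => ?_)
    · exfalso
      apply h
      simp only [setReg_reg, BinOp.eval, Nat.reduceEqDiff, if_true, if_false, ofNat_three, rd3,
        initState, BitVec.toNat_ofNat, Nat.mod_eq_of_lt hp,
        Nat.mod_eq_of_lt (show min L (2 ^ w - 1) < 2 ^ w by omega)]
      rw [if_neg (by omega)]
    · refine runs_tree env hw hq (by omega) hb rd6 rd7 hidx.rp_lt hidx.rd_rp hidx.root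
        ⟨?_, ?_, ?_, ?_⟩ ?_ ?_ ?_
      · simp [initState]
      · simp
      · simp
      · simp only [setReg_reg, BinOp.eval, Nat.reduceEqDiff, if_true, if_false, ofNat_three]
      · simp [initState]
      · simp [initState]
      · simp [initState]
  obtain ⟨τ', s', hex', hτ', hs'⟩ := hrun
  refine ⟨τ', s', hex', ?_, hs'⟩
  have h3 : τ' ≤ 10 * occ t (List.replicate j₀ none ++ q)
    + 44 * (List.replicate j₀ none ++ q).length + 32 := by omega
  exact_mod_cast h3

lemma cell_of_block {base : ℕ} (hB : Block idxB base idxA) (hlen : idxB.length ≤ 2 ^ w)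
    (hA : idxA.length < 2 ^ w) (a : BitVec w) :
    cell idxA a = if a.toNat < (BitVec.ofNat w idxA.length).toNat then
      cell idxB (BitVec.ofNat w base + a) else 0 := by
  have hle := hB.length_le
  rw [BitVec.toNat_ofNat, Nat.mod_eq_of_lt hA]
  have ha : a = BitVec.ofNat w a.toNat := by simp
  split_ifs with h
  · conv_rhs => rw [ha, ← BitVec.ofNat_add, cell_ofNat _ (by omega), hB.rd_eq h]
    simp [cell, List.getD_eq_getElem?_getD, h]
  · simp [cell, List.getD_eq_getElem?_getD, Nat.le_of_not_lt h]

lemma rd_concat {A : List (BitVec w)} {b : BitVec w} {z : ℕ} (hz : z = A.length) :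
    rd (A ++ [b]) z = b := by
  subst hz
  simp [rd]

lemma exists_tree_index {L k H : ℕ} (hσ : σ < 2 ^ w) (ht : t ≠ [])
    (hH : min L (suffixTreeHeight t) = H) (hH1 : 1 ≤ H)
    (hM : idxA.length + 105 * (t.length * H ^ k) ≤ 2 ^ w) :
    ∃ idx tb rp root, idx.length ≤ idxA.length + 106 * (t.length * H ^ k) ∧
      (idx.length ≤ 2 ^ w → IsTreeIndex t L k idxA idx tb rp root) := by
  have hn : 1 ≤ t.length := List.length_pos_iff.mpr ht
  have hHk : t.length * 1 ≤ t.length * H ^ k := Nat.mul_le_mul_left _ (Nat.one_le_pow _ _ hH1)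
  set hd : ℕ → List (BitVec w) := fun rp =>
    [BitVec.ofNat w (2 ^ w - 1), 0, 0, BitVec.ofNat w (min L (2 ^ w - 1)),
      BitVec.ofNat w 8, BitVec.ofNat w idxA.length, BitVec.ofNat w (8 + idxA.length),
      BitVec.ofNat w rp] with hhd
  set tx : List (BitVec w) := t.map (fun a => BitVec.ofNat w (a.val + 1)) ++ [0] with htx
  have htxl : tx.length = t.length + 1 := by simp [htx]
  -- The header precedes the tree, so it cannot hold the address of the root, which is known only
  -- afterwards. It refers to a cell at a position fixed in advance, reached by padding with zeros,
  -- and that cell holds the address.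
  set rp := 8 + idxA.length + (t.length + 1) + 95 * t.length * H ^ k with hrp
  have hhdl : (hd rp).length = 8 := rfl
  have h95 : 95 * t.length * H ^ k = 95 * (t.length * H ^ k) := by ring
  obtain ⟨ext, x, hext, hrep⟩ := build_tree (w := w) (t := t) (L := L) hσ hH1
    (fun d₀ s _ hs => hH ▸ card_branchDepths_le hs)
    (fun s hs => hH ▸ card_branchDepths_zero_le hs) ht k (hd rp ++ idxA ++ tx)
    (by simp only [List.length_append]; omega)
  refine ⟨hd rp ++ idxA ++ tx ++ ext ++
    (List.replicate (95 * t.length * H ^ k - ext.length) 0 ++ [BitVec.ofNat w x]),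
    8 + idxA.length, rp, x, ?_, fun hlen => ⟨hlen, ?_, ?_, ?_, ?_, ?_, hrep.append _⟩⟩
  · simp only [List.length_append, List.length_replicate, List.length_cons, List.length_nil]
    omega
  · exact ⟨[], _, by simp only [List.append_assoc, List.nil_append]; rfl, rfl⟩
  · exact ⟨hd rp, _, by simp only [List.append_assoc]; rfl, rfl⟩
  · exact ⟨hd rp ++ idxA, ext ++
      (List.replicate (95 * t.length * H ^ k - ext.length) 0 ++ [BitVec.ofNat w x]),
      by simp only [htx, List.append_assoc], by simp [hhdl]⟩
  · simp only [List.length_append, List.length_replicate, List.length_cons,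
      List.length_nil] at hlen
    omega
  · rw [← List.append_assoc]
    refine rd_concat ?_
    simp only [List.length_append, List.length_replicate]
    omega

end Reduction

/-! ### Conclusion: the choice of the threshold -/

lemma numChars_add_numWild {σ : ℕ} (p : Pattern σ) : numChars p + numWild p = p.length := by
  rw [numChars, numWild, List.length_eq_countP_add_countP Option.isSome]
  congr 2
  funext x
  cases x <;> rfl

end WildcardIndexing

open WildcardIndexing in
theorem mainTheorem10 (c : ℝ) :
    ∃ C : ℝ, ∀ progA : WildcardIndexing.Program, ∃ progB : WildcardIndexing.Program,
      ∀ (w k σ : ℕ) (t : WildcardIndexing.Text σ)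
        (F : WildcardIndexing.Pattern σ → ℝ) (G S : ℝ) (idxA : List (BitVec w)),
        t ≠ [] → σ < 2 ^ w → t.length < 2 ^ w →
        (∀ p, (WildcardIndexing.numChars p : ℝ) ≤ F p) → 0 ≤ G →
        (idxA.length : ℝ) ≤ S →
        WildcardIndexing.IsBoundedWildcardIndex k progA idxA t
          (fun p => c * (F p + G + (WildcardIndexing.occ t p : ℝ))) →
        C * ((t.length : ℝ) * min G (WildcardIndexing.suffixTreeHeight t : ℝ) ^ k + S)
          ≤ (2 : ℝ) ^ w →
        ∃ idxB : List (BitVec w),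
          (idxB.length : ℝ) ≤
            C * ((t.length : ℝ) * min G (WildcardIndexing.suffixTreeHeight t : ℝ) ^ k + S) ∧
          WildcardIndexing.IsBoundedWildcardIndex k progB idxB t
            (fun p => C * (F p + (WildcardIndexing.numWild p : ℝ)
              + (WildcardIndexing.occ t p : ℝ))) := by
  -- The factor `10` is the simulation factor `5` times the `2` from `G ≤ F + j`. The `1000`
  -- generously covers the additive costs and the constants of the tree; `|c|` is used because `c`
  -- may be negative.
  refine ⟨10 * |c| + 1000, fun progA => ⟨reductionProgram progA, ?_⟩⟩
  intro w k σ t F G S idxA ht hσ hn hF hG hS hA hM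
  have hn1 : 1 ≤ t.length := List.length_pos_iff.mpr ht
  have hw : 0 < w := by
    rcases Nat.eq_zero_or_pos w with rfl | h
    · rw [pow_zero] at hn; omega
    · exact h
  have hc := abs_nonneg c
  set X : ℝ := (t.length : ℝ) * min G (suffixTreeHeight t : ℝ) ^ k with hX
  have hX0 : 0 ≤ X := by positivity
  have hS0 : (0 : ℝ) ≤ S := le_trans (Nat.cast_nonneg _) hS
  have hbig : 1000 * (X + S) ≤ (10 * |c| + 1000) * (X + S) := by
    have : 0 ≤ |c| * (X + S) := by positivity
    linarith
  -- the time of the queries that are passed on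
  have hlong : ∀ p : Pattern σ, 0 < numChars p → G ≤ p.length →
      5 * (c * (F p + G + (occ t p : ℝ))) + 11
        ≤ (10 * |c| + 1000) * (F p + (numWild p : ℝ) + (occ t p : ℝ)) := by
    intro p hp hGp
    have h1 : (p.length : ℝ) = numChars p + numWild p := by
      exact_mod_cast (numChars_add_numWild p).symm
    have h2 : (1 : ℝ) ≤ numChars p := by exact_mod_cast hp
    have h3 := hF p
    have h4 : (0 : ℝ) ≤ numWild p := Nat.cast_nonneg _
    have h5 : (0 : ℝ) ≤ occ t p := Nat.cast_nonneg _
    have h6 : c * (F p + G + (occ t p : ℝ)) ≤ |c| * (F p + G + (occ t p : ℝ)) :=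
      mul_le_mul_of_nonneg_right (le_abs_self c) (by linarith)
    have h7 : |c| * (F p + G + (occ t p : ℝ))
        ≤ |c| * (2 * (F p + (numWild p : ℝ) + (occ t p : ℝ))) :=
      mul_le_mul_of_nonneg_left (by linarith) hc
    nlinarith
  have hSA : 1000 * S ≤ (2 : ℝ) ^ w := by linarith
  have hAlt : idxA.length < 2 ^ w := by
    have h2 : (0 : ℝ) < 2 ^ w := by positivity
    have : (idxA.length : ℝ) < 2 ^ w := by linarith
    exact_mod_cast this
  -- If `G < 1`, every pattern has at least `G` symbols, and the stored threshold `0` passes all of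
  -- them on. A tree could not be afforded, since `min G h ^ k` may be arbitrarily small.
  rcases lt_or_ge G 1 with hG1 | hG1
  · -- no tree
    have hGp : ∀ p : Pattern σ, 0 < numChars p → 0 < p.length ∧ G ≤ p.length := by
      intro p hp
      have h1 : 1 ≤ p.length := by have := numChars_add_numWild p; omega
      have h2 : (1 : ℝ) ≤ p.length := by exact_mod_cast h1
      exact ⟨h1, by linarith⟩
    -- The space bound can be `0`, so an empty index must not receive a header; it needs none, as
    -- all cells of the empty array read as `0`. Otherwise `1 ≤ S` pays for the eight words.
    rcases eq_or_ne idxA [] with rfl | hne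
    · refine ⟨[], by simp only [List.length_nil, Nat.cast_zero]; positivity, ?_⟩
      intro p hp hk hlen
      obtain ⟨T, s, h1, h2, h3⟩ :=
        answers_of_long (P := progA) (idxA := []) (idxB := []) hw (by simp [cell])
        (by simpa [cell] using (hGp p hp).1) hlen (hA p hp hk hlen)
      exact ⟨T, s, h1, h2.trans (hlong p hp (hGp p hp).2), h3⟩
    · set hd : List (BitVec w) := [0, 0, 0, 0, BitVec.ofNat w 8, BitVec.ofNat w idxA.length, 0, 0]
        with hhd
      have hA1 : 1 ≤ idxA.length := List.length_pos_iff.mpr hne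
      have hA1' : (1 : ℝ) ≤ idxA.length := by exact_mod_cast hA1
      have hBlen : ((hd ++ idxA).length : ℝ) = 8 + idxA.length := by simp [hhd]; ring
      have hBlt : (hd ++ idxA).length < 2 ^ w := by
        have : ((hd ++ idxA).length : ℝ) < 2 ^ w := by linarith
        exact_mod_cast this
      have h8 : 8 < 2 ^ w := by
        simp [hhd] at hBlt; omega
      have hcell : ∀ i (hi : i < 8), cell (hd ++ idxA) (BitVec.ofNat w i) = rd hd i := by
        intro i hi
        rw [cell_ofNat _ (by omega), rd_append_left _ _ (by simpa [hhd] using hi)]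
      refine ⟨hd ++ idxA, by linarith, ?_⟩
      intro p hp hk hlen
      have hrel := cell_of_block (idxB := hd ++ idxA) (base := 8) ⟨hd, [], by simp, rfl⟩
        hBlt.le hAlt
      obtain ⟨T, s, h1, h2, h3⟩ :=
        answers_of_long (P := progA) (idxA := idxA) (idxB := hd ++ idxA) hw
        (by rw [hcell 4 (by omega), hcell 5 (by omega)]; exact hrel)
        (by rw [hcell 3 (by omega)]; exact (hGp p hp).1) hlen (hA p hp hk hlen)
      exact ⟨T, s, h1, h2.trans (hlong p hp (hGp p hp).2), h3⟩
  · -- the tree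
    -- Rounding down keeps `min L h ≤ min G h` for the space, while a length above `L` is still at
    -- least `G`.
    set L := ⌊G⌋₊ with hL
    have hL1 : 1 ≤ L := Nat.one_le_floor_iff G |>.mpr hG1
    have hH1 : 1 ≤ min L (suffixTreeHeight t) := le_min hL1 one_le_suffixTreeHeight
    have hHX : ((t.length * min L (suffixTreeHeight t) ^ k : ℕ) : ℝ) ≤ X := by
      push_cast
      refine mul_le_mul_of_nonneg_left (pow_le_pow_left₀ (by positivity) ?_ k) (by positivity)
      exact min_le_min (Nat.floor_le hG) le_rfl
    have hpos : 1 ≤ t.length * min L (suffixTreeHeight t) ^ k :=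
      Nat.mul_pos hn1 (Nat.pow_pos hH1)
    have hX1 : (1 : ℝ) ≤ X := le_trans (by exact_mod_cast hpos) hHX
    have hfit : idxA.length + 106 * (t.length * min L (suffixTreeHeight t) ^ k) ≤ 2 ^ w := by
      have : ((idxA.length + 106 * (t.length * min L (suffixTreeHeight t) ^ k) : ℕ) : ℝ)
          ≤ 2 ^ w := by
        rw [Nat.cast_add, Nat.cast_mul]
        push_cast at hHX ⊢
        linarith
      exact_mod_cast this
    obtain ⟨idxB, tb, rp, root, hlen, hidx⟩ := exists_tree_index (idxA := idxA) (k := k) hσ ht rfl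
      hH1 (by omega)
    have hidx := hidx (by omega)
    have hw3 : 3 ≤ w := by
      have h1 := hidx.header.length_le
      simp only [List.length_cons, List.length_nil] at h1
      have h2 := hidx.length_le
      rw [← Nat.pow_le_pow_iff_right (a := 2) (by norm_num)]
      omega
    refine ⟨idxB, ?_, ?_⟩
    · have h1 : (idxB.length : ℝ)
          ≤ ((idxA.length + 106 * (t.length * min L (suffixTreeHeight t) ^ k) : ℕ) : ℝ) := by
        exact_mod_cast hlen
      rw [Nat.cast_add, Nat.cast_mul] at h1
      push_cast at hHX h1
      linarith
    · intro p hp hk hplen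
      rcases lt_or_ge L p.length with hLp | hLp
      · have hGp : G ≤ p.length := by
          have h1 := Nat.lt_floor_add_one G
          have h2 : ((L + 1 : ℕ) : ℝ) ≤ p.length := by exact_mod_cast hLp
          push_cast at h2
          linarith
        have h8 : 8 ≤ 2 ^ w :=
          (show 2 ^ 3 ≤ 2 ^ w from Nat.pow_le_pow_right (by norm_num) hw3)
        have r3 := hidx.header.rd_eq (i := 3) (by simp)
        have r4 := hidx.header.rd_eq (i := 4) (by simp)
        have r5 := hidx.header.rd_eq (i := 5) (by simp)
        simp only [zero_add, List.getElem_cons_succ, List.getElem_cons_zero] at r3 r4 r5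
        have hrel := cell_of_block hidx.index hidx.length_le hAlt
        obtain ⟨T, s, h1, h2, h3⟩ := answers_of_long (P := progA) (idxA := idxA) (idxB := idxB) hw
          (by
            rw [cell_ofNat _ (show 4 < 2 ^ w by omega), cell_ofNat _ (show 5 < 2 ^ w by omega),
              r4, r5]
            exact hrel)
          (by
            rw [cell_ofNat _ (show 3 < 2 ^ w by omega), r3, BitVec.toNat_ofNat,
              Nat.mod_eq_of_lt (by omega)]
            omega) hplen (hA p hp hk hplen)
        exact ⟨T, s, h1, h2.trans (hlong p hp hGp), h3⟩
      · obtain ⟨T, s, h1, h2, h3⟩ :=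
          answers_of_short (P := progA) hw3 hσ hn hidx hp hk hplen hLp
        refine ⟨T, s, h1, h2.trans ?_, h3⟩
        have h4 : (p.length : ℝ) = numChars p + numWild p := by
          exact_mod_cast (numChars_add_numWild p).symm
        have h5 : (1 : ℝ) ≤ numChars p := by exact_mod_cast hp
        have h6 := hF p
        have h7 : (0 : ℝ) ≤ numWild p := Nat.cast_nonneg _
        have h8 : (0 : ℝ) ≤ occ t p := Nat.cast_nonneg _
        have h9 : 0 ≤ |c| * (F p + (numWild p : ℝ) + (occ t p : ℝ)) :=
          mul_nonneg hc (by linarith)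
        rw [h4]
        linarith
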